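/- Notation. Let $(a;q)_\infty=\prod_{j\ge 0}(1-aq^j)$ and $(a,b;q)_\infty=(a;q)_\infty(b;q)_\infty$. Define the following formal series in $q$, whose coefficients are Laurent polynomials in $z$ with integer coefficients: $$S_{A5}(z,q)=\sum_{n\ge1}\frac{q^{n^2+n}(q^{2n+1};q)_\infty}{(zq^n,z^{-1}q^n;q)_\infty},\qquad S_{A7}(z,q)=\sum_{n\ge1}\frac{q^{n^2}(q^{2n+1};q)_\infty}{(zq^n,z^{-1}q^n;q)_\infty},$$ $$S_{C5}(z,q)=\sum_{n\ge1}\frac{q^{(n^2+n)/2}(q^{2n+1};q^2)_\infty(q^{n+1};q)_\infty}{(zq^n,z^{-1}q^n;q)_\infty}.$$ For $X\in\{A5,A7,C5\}$ write $S_X(z,q)=\sum_{n\ge1}\sum_{m\in\mathbb Z}M_X(m,n)z^mq^n$ and let $M_X(k,t,n)=\sum_{m\equiv k\ (\mathrm{mod}\ t)}M_X(m,n)$. For a partition $\pi$ let $s(\pi)$ be its smallest part, and let $PP$ be the set of pairs $(\pi_1,\pi_2)$ of partitions such that $\pi_1$ is non-empty and every part of $\pi_2$ is larger than $s(\pi_1)$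 and at most $2s(\pi_1)$; such a pair is a pair of $n$ if all the parts of $\pi_1$ and $\pi_2$ together sum to $n$. For $n\ge0$ define * $\mathrm{spt}_{A5}(n)$: the sum over the pairs $(\pi_1,\pi_2)\in PP$ of $n$ of the number of times $s(\pi_1)$ appears in $\pi_1$ past the first $s(\pi_1)$ times, that is, of $\max(0,c-s(\pi_1))$, where $c$ is the number of appearances of $s(\pi_1)$ in $\pi_1$; * $\mathrm{spt}_{A7}(n)$: the sum over the same pairs of the number of times $s(\pi_1)$ appears in $\pi_1$ past the first $s(\pi_1)-1$ times, that is, of $\max(0,c-s(\pi_1)+1)$; * $\mathrm{spt}(n)$: the total number of appearances of the smallest part in the partitions of $n$ (with $\mathrm{spt}(0)=0$); * $\mathrm{spt}_{C1}(n)$: the total number of appearances of the smallest part in those partitions $\pi$ of $n$ all of whose odd parts are less than $2s(\pi)$ (with $\mathrm{spt}_{C1}(0)=0$); * $\mathrm{spt}_{C5}(n)=\mathrm{spt}_{C1}(n)-\mathrm{spt}(n/2)$, where $\mathrm{spt}(n/2)=0$ if $n$ is odd. **Corollary.** For every integer $n\ge0$ and every $k\in\{0,1,2,3,4\}$, $$M_{A5}(k,5,5n+4)=\tfrac15\,\mathrm{spt}_{A5}(5n+4),\qquad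 M_{A7}(k,5,5n+4)=\tfrac15\,\mathrm{spt}_{A7}(5n+4),\qquad M_{C5}(k,5,5n+3)=\tfrac15\,\mathrm{spt}_{C5}(5n+3).$$ In particular, in each of the three cases the five residue-class counts are equal. -/

import Mathlib

open scoped LaurentPolynomial PowerSeries

noncomputable section

namespace SptCrank

/-! ### Two-variable `q`-series

Series in `q` whose coefficients are Laurent polynomials in `z` with integer coefficients. The
power series variable `X` is `q`, and `z` is `T 1`. -/

/-- The ring `ℤ[z, z⁻¹]⟦q⟧`. -/
abbrev ZQSeries : Type := ℤ[T;T⁻¹]⟦X⟧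

/-- The variable `q`. -/
def q : ZQSeries := PowerSeries.X

/-- The monomial `z ^ m`, for an integer `m`. -/
def z (m : ℤ) : ZQSeries := PowerSeries.C (LaurentPolynomial.T m)

/-- The infinite product `(a; q^b)_∞ = ∏_{j ≥ 0} (1 - a q^(b j))`, for `b ≥ 1`. The factors with
`j > N` do not contribute to the coefficient of `q^N` (see `coeff_qPochInf`). -/
def qPochInf (a : ZQSeries) (b : ℕ) : ZQSeries :=
  PowerSeries.mk fun N => PowerSeries.coeff N (∏ j ∈ Finset.range (N + 1), (1 - a * q ^ (b * j)))

/-- The infinite sum `∑_{n ≥ 1} t n` of series such that `q^n` divides `t n`. The terms with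
`n > N` do not contribute to the coefficient of `q^N` (see `coeff_qSum`). -/
def qSum (t : ℕ → ZQSeries) : ZQSeries :=
  PowerSeries.mk fun N => PowerSeries.coeff N (∑ n ∈ Finset.Icc 1 N, t n)

/-- The coefficients of `(a; q^b)_∞` are those of all long enough partial products. -/
theorem coeff_qPochInf (a : ZQSeries) {b : ℕ} (hb : 1 ≤ b) {N M : ℕ} (h : N < M) :
    PowerSeries.coeff N (qPochInf a b) =
      PowerSeries.coeff N (∏ j ∈ Finset.range M, (1 - a * q ^ (b * j))) := by
  induction M, h using Nat.le_induction with
  | base => simp [qPochInf]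
  | succ M hM ih =>
    have hlt : N < b * M := lt_of_lt_of_le hM (Nat.le_mul_of_pos_left M hb)
    rw [ih, Finset.prod_range_succ, mul_sub, mul_one, map_sub, ← mul_assoc, q,
      PowerSeries.coeff_mul_X_pow', if_neg (not_le.mpr hlt), sub_zero]

/-- The coefficients of `∑_{n ≥ 1} t n` are those of all long enough partial sums. -/
theorem coeff_qSum {t : ℕ → ZQSeries} (ht : ∀ n, q ^ n ∣ t n) {N M : ℕ} (h : N ≤ M) :
    PowerSeries.coeff N (qSum t) = PowerSeries.coeff N (∑ n ∈ Finset.Icc 1 M, t n) := by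
  induction M, h using Nat.le_induction with
  | base => simp [qSum]
  | succ M hM ih =>
    rw [ih, Finset.sum_Icc_succ_top (by omega), map_add,
      PowerSeries.X_pow_dvd_iff.mp (ht (M + 1)) N (by omega), add_zero]

/-- `(z q^n, z⁻¹ q^n; q)_∞`. -/
def crankDenom (n : ℕ) : ZQSeries :=
  qPochInf (z 1 * q ^ n) 1 * qPochInf (z (-1) * q ^ n) 1

/-- `1 / (z q^n, z⁻¹ q^n; q)_∞`, for `n ≥ 1`. -/
def crankFactor (n : ℕ) : ZQSeries :=
  PowerSeries.invOfUnit (crankDenom n) 1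

/-- `crankFactor n` is the multiplicative inverse of `(z q^n, z⁻¹ q^n; q)_∞`. -/
theorem crankDenom_mul_crankFactor {n : ℕ} (hn : 1 ≤ n) : crankDenom n * crankFactor n = 1 := by
  apply PowerSeries.mul_invOfUnit
  have h : ∀ m : ℤ, PowerSeries.constantCoeff (qPochInf (z m * q ^ n) 1) = 1 := by
    intro m
    rw [← PowerSeries.coeff_zero_eq_constantCoeff_apply, qPochInf, PowerSeries.coeff_mk]
    simp [q, show n ≠ 0 by omega]
  rw [crankDenom, map_mul, h, h]
  simp

/-- `S_{A5}(z,q) = ∑_{n ≥ 1} q^(n²+n) (q^(2n+1); q)_∞ / (z q^n, z⁻¹ q^n; q)_∞`. -/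
def SA5 : ZQSeries :=
  qSum fun n => q ^ (n ^ 2 + n) * qPochInf (q ^ (2 * n + 1)) 1 * crankFactor n

/-- `S_{A7}(z,q) = ∑_{n ≥ 1} q^(n²) (q^(2n+1); q)_∞ / (z q^n, z⁻¹ q^n; q)_∞`. -/
def SA7 : ZQSeries :=
  qSum fun n => q ^ (n ^ 2) * qPochInf (q ^ (2 * n + 1)) 1 * crankFactor n

/-- `S_{C5}(z,q) =
∑_{n ≥ 1} q^((n²+n)/2) (q^(2n+1); q²)_∞ (q^(n+1); q)_∞ / (z q^n, z⁻¹ q^n; q)_∞`. -/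
def SC5 : ZQSeries :=
  qSum fun n => q ^ ((n ^ 2 + n) / 2) * (qPochInf (q ^ (2 * n + 1)) 2 * qPochInf (q ^ (n + 1)) 1) *
    crankFactor n

/-- The coefficient `M(m,n)` of `z^m q^n` in `S(z,q)`. -/
def crankCoeff (S : ZQSeries) (m : ℤ) (n : ℕ) : ℤ :=
  (PowerSeries.coeff n S).coeff m

/-- `M(k,t,n) = ∑_{m ≡ k (mod t)} M(m,n)`, a sum with finitely many nonzero terms. -/
def crankResidue (S : ZQSeries) (k : ℤ) (t : ℕ) (n : ℕ) : ℤ :=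
  ∑ m ∈ (PowerSeries.coeff n S).coeff.support with m ≡ k [ZMOD t], crankCoeff S m n

/-! ### The smallest parts functions -/

/-- The smallest part of a partition (`0` for the empty partition). -/
def smallest {n : ℕ} (π : n.Partition) : ℕ :=
  sInf {i | i ∈ π.parts}

/-- The number of times that the smallest part of a partition appears (`0` for the empty
partition). -/
def smallestCount {n : ℕ} (π : n.Partition) : ℕ :=
  π.parts.count (smallest π)

/-- Andrews' function `spt(n)`. -/
def spt (n : ℕ) : ℕ :=
  ∑ π : n.Partition, smallestCount π

/-- The pairs `(π₁, π₂)` where `π₁` is non-empty and all parts of `π₂` are larger than the smallest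
part `s(π₁)` of `π₁` but no more than `2 s(π₁)`. -/
def IsPP {a b : ℕ} (π₁ : a.Partition) (π₂ : b.Partition) : Prop :=
  π₁.parts ≠ 0 ∧ ∀ i ∈ π₂.parts, smallest π₁ < i ∧ i ≤ 2 * smallest π₁

open Classical in
/-- The sum of `w π₁` over the partition pairs `(π₁, π₂)` of `n` that satisfy `IsPP`. -/
def pairSum (w : ∀ a : ℕ, a.Partition → ℕ) (n : ℕ) : ℕ :=
  ∑ ab ∈ Finset.HasAntidiagonal.antidiagonal n, ∑ π₁ : ab.1.Partition, ∑ π₂ : ab.2.Partition,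
    if IsPP π₁ π₂ then w ab.1 π₁ else 0

/-- `spt_{A5}(n)`: each pair is weighted by the number of times that `s(π₁)` appears in `π₁` past
the first `s(π₁)` times (truncated subtraction: this is `0` if it appears at most `s(π₁)` times). -/
def sptA5 (n : ℕ) : ℕ :=
  pairSum (fun _ π₁ => smallestCount π₁ - smallest π₁) n

/-- `spt_{A7}(n)`: each pair is weighted by the number of times that `s(π₁)` appears in `π₁` past
the first `s(π₁) - 1` times (truncated subtraction). -/
def sptA7 (n : ℕ) : ℕ :=
  pairSum (fun _ π₁ => smallestCount π₁ - (smallest π₁ - 1)) n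

open Classical in
/-- `spt_{C1}(n)`: the total number of appearances of the smallest part in the partitions `π` of `n`
all of whose odd parts are less than twice the smallest part of `π`. -/
def sptC1 (n : ℕ) : ℕ :=
  ∑ π : n.Partition with ∀ i ∈ π.parts, Odd i → i < 2 * smallest π, smallestCount π

/-- `spt_{C5}(n) = spt_{C1}(n) - spt(n/2)`, where `spt(n/2) = 0` for odd `n`. -/
def sptC5 (n : ℕ) : ℤ :=
  (sptC1 n : ℤ) - if Even n then (spt (n / 2) : ℤ) else 0

end SptCrank

end

/-! Two facts about each series S(z,q) suffice. At z = 1 it is the generating function of the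
corresponding spt function, and at a primitive fifth root of unity ζ its coefficients vanish in the
stated residue class mod 5. The coefficient of q^N in S(ζ,q) is Σ_k M(k,5,N) ζ^k with 0 ≤ k ≤ 4, and
ζ has degree 4 over ℚ, so vanishing makes the five counts equal, each a fifth of the coefficient at
z = 1 (`five_mul_crankResidue`).

Vanishing: a finite Jacobi triple product (`pairPoch_expansion`) expands (zq, q/z; q)_(n-1) in the
antisymmetric z^i - z^(-i). Summing over n with Durfee-type identities turns (1/z - z) (zq, q/z;
q)_∞ S into a theta-like series with quadratic exponents (`theta_A5`, `theta_A7_sub_A5`,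
`theta_C5`). At z = ζ, multiply by (ζ²q, ζ³q; q)_∞ (q)_∞: the products on the left combine to
(q⁵;q⁵)_∞, while on the right `jacobi_triple_product` gives a second theta series whose surviving
exponents are 0 or 1 mod 5. Sums of the two exponents miss the class 4 (A5 and A7 - A5) or 3 (C5),
and dividing by a series in q⁵ preserves this (`coeff_evalZ_eq_zero`).

Value at z = 1: for A5 and A7 the summands are products of geometric series that count the pairs
directly. For C5 one needs `sum_C1_eq`: the series of spt_C1 is that of C5 plus the series of spt in
q². It follows by expanding 1/(q)_n and summing with a q-analogue of Gauss's second theorem.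

The q-series identities are proved in a commutative ring with q^M = 0, where infinite products are
finite and 1 - c q^k is a unit for k ≥ 1; they are then applied in A⟦q⟧/(q^M) for every M. -/

namespace SptCrank

/-! ### Infinite products for nilpotent q, and telescoping summation identities -/

section NilpotentBase

variable {R : Type*} [CommRing R]

open Finset

/-- The product `(a; q)_M`, which plays the role of `(a; q)_∞` when `q ^ M = 0`. -/
def poch (q : R) (M : ℕ) (a : R) : R := ∏ j ∈ range M, (1 - a * q ^ j)

/-- The factor with j = M equals 1, so shifting a to aq only removes the first factor, as for a
genuine infinite product. -/
theorem poch_eq_mul {q : R} {M : ℕ} (hq : q ^ M = 0) (a : R) :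
    poch q M a = (1 - a) * poch q M (a * q) := by
  have h1 := prod_range_succ (fun j => 1 - a * q ^ j) M
  have h2 := prod_range_succ' (fun j => 1 - a * q ^ j) M
  rw [h1] at h2
  simp only [hq, mul_zero, sub_zero, mul_one, pow_zero] at h2
  rw [poch, h2, mul_comm, poch]
  congr 1
  exact prod_congr rfl fun j _ => by ring

theorem pow_eq_zero_of_ge {q : R} {M : ℕ} (hq : q ^ M = 0) {n : ℕ} (h : M ≤ n) : q ^ n = 0 :=
  pow_eq_zero_of_le h hq

theorem poch_eq_one {q : R} {M : ℕ} (hq : q ^ M = 0) {k : ℕ} (h : M ≤ k) (c : R) :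
    poch q M (c * q ^ k) = 1 :=
  prod_eq_one fun j _ => by
    rw [mul_assoc, ← pow_add, pow_eq_zero_of_ge hq (by omega), mul_zero, sub_zero]

theorem poch_pow_succ {q : R} {M : ℕ} (hq : q ^ M = 0) (c : R) (k : ℕ) :
    poch q M (c * q ^ k) = (1 - c * q ^ k) * poch q M (c * q ^ (k + 1)) := by
  rw [poch_eq_mul hq, pow_succ, mul_assoc]

/-- The product `(q^k; q)_∞` when `q ^ M = 0`. -/
def tail (q : R) (M k : ℕ) : R := poch q M (q ^ k)

theorem tail_step {q : R} {M : ℕ} (hq : q ^ M = 0) (k : ℕ) :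
    tail q M k = (1 - q ^ k) * tail q M (k + 1) := by
  rw [tail, poch_eq_mul hq, tail, pow_succ]

theorem tail_zero {q : R} {M : ℕ} (hq : q ^ M = 0) : tail q M 0 = 0 := by
  rw [tail_step hq]; simp

theorem tail_eq_one {q : R} {M : ℕ} (hq : q ^ M = 0) {k : ℕ} (h : M ≤ k) : tail q M k = 1 := by
  simpa [tail] using poch_eq_one hq h (1 : R)

theorem isUnit_one_sub_mul {q : R} {M : ℕ} (hq : q ^ M = 0) (c : R) {k : ℕ} (hk : k ≠ 0) :
    IsUnit (1 - c * q ^ k) := by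
  refine IsNilpotent.isUnit_one_sub ⟨M, ?_⟩
  rw [mul_pow, ← pow_mul, pow_eq_zero_of_ge hq (Nat.le_mul_of_pos_left _ (by omega)), mul_zero]

theorem isUnit_one_sub_pow {q : R} {M : ℕ} (hq : q ^ M = 0) {k : ℕ} (hk : k ≠ 0) :
    IsUnit (1 - q ^ k) := by
  simpa using isUnit_one_sub_mul hq 1 hk

theorem isUnit_poch {q : R} {M : ℕ} (hq : q ^ M = 0) (c : R) {k : ℕ} (hk : k ≠ 0) :
    IsUnit (poch q M (c * q ^ k)) := by
  rw [poch, IsUnit.prod_iff]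
  intro j _
  rw [mul_assoc, ← pow_add]
  exact isUnit_one_sub_mul hq c (by omega)

theorem isUnit_tail {q : R} {M : ℕ} (hq : q ^ M = 0) {k : ℕ} (hk : k ≠ 0) :
    IsUnit (tail q M k) := by
  simpa [tail] using isUnit_poch hq 1 hk

theorem choose_two_succ (n : ℕ) : (n + 1).choose 2 = n.choose 2 + n := by
  rw [Nat.choose_succ_succ' n 1, Nat.choose_one_right, add_comm]

theorem le_choose_two_succ (n : ℕ) : n ≤ (n + 1).choose 2 := by
  rw [choose_two_succ]; omega

/-- A sequence that is constant and eventually equal to `c` equals `c`. -/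
theorem eq_of_step {α : Type*} {D : ℕ → α} {c : α} (h : ∀ n, D (n + 1) = D n) {K : ℕ} (hK : D K = c) (n : ℕ) :
    D n = c := by
  have h0 : ∀ n, D n = D 0 := fun n => by
    induction n with
    | zero => rfl
    | succ n ih => rw [h, ih]
  rw [h0 n, ← h0 K, hK]

/-- Cauchy's identity `∑ q^(m² + N m) / ((q)_m (q)_(m+N)) = 1 / (q)_∞`, times `(q)_∞²`. -/
theorem sum_durfee {q : R} {M : ℕ} (hq : q ^ M = 0) (N : ℕ) :
    ∑ m ∈ range M, q ^ (m ^ 2 + N * m) * tail q M (m + 1) * tail q M (m + N + 1) = tail q M 1 := by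
  rcases Nat.eq_zero_or_pos M with rfl | hM
  · simpa using (Subsingleton.elim (h := subsingleton_of_zero_eq_one (by simpa using hq.symm)) _ _)
  refine eq_of_step (D := fun N => ∑ m ∈ range M,
    q ^ (m ^ 2 + N * m) * tail q M (m + 1) * tail q M (m + N + 1)) (K := M) (fun N => ?_) ?_ N
  · rw [← sub_eq_zero, ← sum_sub_distrib]
    -- Independence of N by telescoping: the certificate is the summand with `tail q M m` in place
    -- of `tail q M (m + 1)`. It vanishes at m = 0 by `tail_zero` and at m = M by the power of q.
    -- The sum is then read off at N = M, where only m = 0 survives.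
    have := sum_range_sub
      (fun m => q ^ (m ^ 2 + N * m) * tail q M m * tail q M (m + N + 1)) M
    rw [tail_zero hq, pow_eq_zero_of_ge hq (show M ≤ M ^ 2 + N * M by nlinarith)] at this
    simp only [zero_mul, mul_zero, sub_zero] at this
    rw [← this]
    refine sum_congr rfl fun m _ => ?_
    rw [tail_step hq m, tail_step hq (m + N + 1), show m + 1 + N + 1 = m + N + 1 + 1 by ring,
      show m + (N + 1) + 1 = m + N + 1 + 1 by ring]
    ring
  · rw [sum_eq_single 0]
    · simp [tail_eq_one hq (show M ≤ M + 1 by omega)]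
    · intro m _ hm
      rw [pow_eq_zero_of_ge hq (show M ≤ m ^ 2 + M * m by
        nlinarith [Nat.pos_of_ne_zero hm]), zero_mul, zero_mul]
    · intro h; simp at h; omega

/-- The product `(-q^k; q)_∞` when `q ^ M = 0`. -/
def negTail (q : R) (M k : ℕ) : R := poch q M ((-1) * q ^ k)

theorem negTail_step {q : R} {M : ℕ} (hq : q ^ M = 0) (k : ℕ) :
    negTail q M k = (1 + q ^ k) * negTail q M (k + 1) := by
  rw [negTail, poch_pow_succ hq, negTail]; ring

theorem negTail_eq_one {q : R} {M : ℕ} (hq : q ^ M = 0) {k : ℕ} (h : M ≤ k) :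
    negTail q M k = 1 := poch_eq_one hq h _

theorem isUnit_negTail {q : R} {M : ℕ} (hq : q ^ M = 0) {k : ℕ} (hk : k ≠ 0) :
    IsUnit (negTail q M k) := isUnit_poch hq _ hk

/-- The finite product `(-q; q)_n`. -/
def negPoch (q : R) (n : ℕ) : R := ∏ j ∈ range n, (1 + q ^ (j + 1))

theorem negPoch_succ (q : R) (n : ℕ) : negPoch q (n + 1) = negPoch q n * (1 + q ^ (n + 1)) :=
  prod_range_succ _ _

theorem negPoch_mul_negTail {q : R} {M : ℕ} (hq : q ^ M = 0) (n : ℕ) :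
    negPoch q n * negTail q M (n + 1) = negTail q M 1 := by
  induction n with
  | zero => simp [negPoch]
  | succ n ih => rw [← ih, negPoch_succ, negTail_step hq (n + 1)]; ring

/-- `∑ q^(m(m+1)/2 + mi) (-q)_(m+i) / ((q)_m (q)_(m+2i+1)) = (-q)_∞ / (q)_∞`, times `(q)_∞²`. -/
theorem sum_negPoch {q : R} {M : ℕ} (hq : q ^ M = 0) (i : ℕ) :
    ∑ m ∈ range M, q ^ ((m + 1).choose 2 + m * i) * negPoch q (m + i) * tail q M (m + 1) *
      tail q M (m + 2 * i + 2) = negTail q M 1 * tail q M 1 := by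
  rcases Nat.eq_zero_or_pos M with rfl | hM
  · simpa using (Subsingleton.elim (h := subsingleton_of_zero_eq_one (by simpa using hq.symm)) _ _)
  refine eq_of_step (D := fun i => ∑ m ∈ range M, q ^ ((m + 1).choose 2 + m * i) *
    negPoch q (m + i) * tail q M (m + 1) * tail q M (m + 2 * i + 2)) (K := M) (fun i => ?_) ?_ i
  · rw [← sub_eq_zero, ← sum_sub_distrib]
    -- Telescoping in i; the last factor of the certificate makes the difference of consecutive sums
    -- exact, and both ends vanish.
    have := sum_range_sub (fun m => q ^ ((m + 1).choose 2 + m * i) * negPoch q (m + i) *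
      tail q M m * tail q M (m + 2 * i + 3) * (1 + q ^ (m + i + 1) * (1 - q ^ (i + 1)))) M
    rw [tail_zero hq, pow_eq_zero_of_ge hq (show M ≤ (M + 1).choose 2 + M * i from
      (le_choose_two_succ M).trans (Nat.le_add_right _ _))] at this
    simp only [zero_mul, mul_zero, sub_zero] at this
    rw [← this]
    refine sum_congr rfl fun m _ => ?_
    rw [tail_step hq m, tail_step hq (m + 2 * i + 2), tail_step hq (m + 2 * i + 3),
      show m + 1 + 2 * i + 3 = m + 2 * i + 3 + 1 by ring,
      show m + 2 * (i + 1) + 2 = m + 2 * i + 3 + 1 by ring,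
      show m + 2 * i + 2 + 1 = m + 2 * i + 3 by ring,
      show m + (i + 1) = m + i + 1 by ring, show m + 1 + i = m + i + 1 by ring,
      negPoch_succ, choose_two_succ (m + 1)]
    ring
  · rw [sum_eq_single 0]
    · have h := negPoch_mul_negTail hq M
      rw [negTail_eq_one hq (show M ≤ M + 1 by omega), mul_one] at h
      simp [tail_eq_one hq (show M ≤ 2 * M + 2 by omega), h]
    · intro m _ hm
      rw [pow_eq_zero_of_ge hq (show M ≤ (m + 1).choose 2 + m * M by
        nlinarith [Nat.pos_of_ne_zero hm]), zero_mul, zero_mul, zero_mul]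
    · intro h; simp at h; omega

end NilpotentBase

/-! ### Finite Jacobi triple product in antisymmetric form -/

section NilpotentBase

variable {R : Type*} [CommRing R]

open Finset

/-- The finite product `(zq, yq; q)_N`. -/
def pairPoch (q z y : R) (N : ℕ) : R := ∏ j ∈ range N, (1 - z * q ^ (j + 1)) * (1 - y * q ^ (j + 1))

/-- When zy = 1, multiplication by z + y shifts z^i - y^i up and down by one; the shift is moved
onto the coefficients, and the boundary hypotheses remove the end terms. -/
theorem mul_sum_of_recurrence {n : ℕ} {f s : ℕ → R} {c : R} (hf0 : f 0 = 0) (hf1 : f (n + 1) = 0)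
    (hf2 : f (n + 2) = 0) (hs0 : s 0 = 0) (hs : ∀ i, s (i + 2) = c * s (i + 1) - s i) :
    c * ∑ i ∈ range (n + 1), f i * s i = ∑ i ∈ range (n + 1), (f i + f (i + 2)) * s (i + 1) := by
  have h1 := sum_range_succ' (fun i => f i * s (i + 1)) n
  have h2 := sum_range_succ' (fun i => f (i + 1) * s i) (n + 1)
  rw [sum_range_succ (fun i => f (i + 1) * s i), sum_range_succ (fun i => f (i + 1) * s i), hf1,
    hf2, hs0] at h2
  simp only [hf0, zero_mul, mul_zero, add_zero] at h1 h2
  simp only [add_mul, sum_add_distrib]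
  rw [h1, ← h2, ← sum_add_distrib, sum_range_succ' _ n, hf0, zero_mul, add_zero, mul_sum]
  exact sum_congr rfl fun i _ => by rw [hs]; ring

/-- The coefficient `q^(i(i-1)/2) (1 - q^i) / ((q)_(n+i) (q)_(n-i))`, times `(q)_∞²`. -/
def pairCoeff (q : R) (M n i : ℕ) : R :=
  q ^ i.choose 2 * (1 - q ^ i) * tail q M (n + i + 1) * tail q M (n + 1 - i)

theorem pairCoeff_zero (q : R) (M n : ℕ) : pairCoeff q M n 0 = 0 := by simp [pairCoeff]

theorem pairCoeff_of_lt {q : R} {M : ℕ} (hq : q ^ M = 0) {n i : ℕ} (h : n < i) :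
    pairCoeff q M n i = 0 := by
  rw [pairCoeff, Nat.sub_eq_zero_of_le (by omega), tail_zero hq, mul_zero]

/-- Coefficient comparison for the induction in `pairPoch_expansion`, with n = i + d: the new factor
is (1 - zq^n)(1 - yq^n) = 1 + q^(2n) - q^n (z + y). -/
theorem pairCoeff_recurrence {q : R} {M : ℕ} (hq : q ^ M = 0) (i d : ℕ) :
    (1 - q ^ (i + d)) * (1 - q ^ (2 * (i + d) + 1)) * (1 - q ^ (2 * (i + d) + 2)) *
        pairCoeff q M (i + d + 1) (i + 1) =
      (1 - q ^ (i + d + 1)) * ((1 + q ^ (2 * (i + d))) * pairCoeff q M (i + d) (i + 1) +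
        q ^ (i + d) * (pairCoeff q M (i + d) i + pairCoeff q M (i + d) (i + 2))) := by
  have e1 : tail q M (2 * i + d + 1) = (1 - q ^ (2 * i + d + 1)) * ((1 - q ^ (2 * i + d + 2)) *
      tail q M (2 * i + d + 3)) := by rw [tail_step hq, tail_step hq (2 * i + d + 2)]
  simp only [pairCoeff, choose_two_succ]
  rw [show i + d + 1 + (i + 1) + 1 = 2 * i + d + 3 by ring,
    show i + d + (i + 1) + 1 = 2 * i + d + 2 by ring,
    show i + d + i + 1 = 2 * i + d + 1 by ring,
    show i + d + (i + 2) + 1 = 2 * i + d + 3 by ring,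
    show i + d + 1 + 1 - (i + 1) = d + 1 by omega,
    show i + d + 1 - (i + 1) = d by omega, show i + d + 1 - i = d + 1 by omega,
    show i + d + 1 - (i + 2) = d - 1 by omega, e1, tail_step hq (2 * i + d + 2)]
  -- At d = 0 the index d - 1 truncates to 0, harmlessly, as `tail q M 0` vanishes.
  cases d with
  | zero => simp only [tail_zero hq, zero_le, Nat.sub_eq_zero_of_le]; ring
  | succ d =>
    rw [show d + 1 - 1 = d by omega, tail_step hq d, tail_step hq (d + 1)]
    ring

/-- Finite form of the Jacobi triple product, with coefficients antisymmetric in `z ↔ z⁻¹`. -/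
theorem pairPoch_expansion {q : R} {M : ℕ} (hq : q ^ M = 0) {z y : R} (hzy : z * y = 1) (N : ℕ) :
    (1 - q ^ (N + 1)) * (y - z) * pairPoch q z y N * tail q M (2 * N + 3) * tail q M 1 =
      ∑ i ∈ range (N + 2), (-1) ^ i * pairCoeff q M (N + 1) i * (z ^ i - y ^ i) := by
  induction N with
  | zero => simp [pairPoch, sum_range_succ, pairCoeff]; ring
  | succ N ih =>
    set n := N + 1 with hn
    have hu : IsUnit ((1 - q ^ n) * (1 - q ^ (2 * n + 1)) * (1 - q ^ (2 * n + 2))) :=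
      ((isUnit_one_sub_pow hq (by omega)).mul (isUnit_one_sub_pow hq (by omega))).mul
        (isUnit_one_sub_pow hq (by omega))
    refine hu.mul_left_cancel ?_
    have hrec := mul_sum_of_recurrence (n := n) (f := fun i => (-1) ^ i * pairCoeff q M n i)
      (s := fun i => z ^ i - y ^ i) (c := z + y) (by simp [pairCoeff_zero])
      (by simp [pairCoeff_of_lt hq (Nat.lt_succ_self n)])
      (by simp [pairCoeff_of_lt hq (show n < n + 2 by omega)]) (by simp)
      (fun i => by linear_combination (y ^ i - z ^ i) * hzy)
    have hS : ∑ i ∈ range (n + 1), (-1) ^ i * pairCoeff q M n i * (z ^ i - y ^ i) =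
        ∑ i ∈ range (n + 1), (-1) ^ (i + 1) * pairCoeff q M n (i + 1) *
          (z ^ (i + 1) - y ^ (i + 1)) := by
      have h := sum_range_succ' (fun i => (-1) ^ i * pairCoeff q M n i * (z ^ i - y ^ i)) (n + 1)
      rw [sum_range_succ, pairCoeff_of_lt hq (Nat.lt_succ_self n), pairCoeff_zero] at h
      simpa using h
    calc _ = (1 - q ^ (n + 1)) * ((1 + q ^ (2 * n)) - q ^ n * (z + y)) *
          ((1 - q ^ n) * (y - z) * pairPoch q z y N * tail q M (2 * N + 3) * tail q M 1) := by
          rw [pairPoch, prod_range_succ, ← pairPoch, ← hn, show 2 * N + 3 = 2 * n + 1 by omega,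
            tail_step hq (2 * n + 1), tail_step hq (2 * n + 1 + 1),
            show 2 * n + 3 = 2 * n + 1 + 1 + 1 by omega]
          have : (1 - z * q ^ n) * (1 - y * q ^ n) = (1 + q ^ (2 * n)) - q ^ n * (z + y) := by
            linear_combination q ^ (2 * n) * hzy
          rw [this]
          ring
      _ = (1 - q ^ (n + 1)) * ((1 + q ^ (2 * n)) * (∑ i ∈ range (n + 1), (-1) ^ (i + 1) *
            pairCoeff q M n (i + 1) * (z ^ (i + 1) - y ^ (i + 1))) -
            q ^ n * (∑ i ∈ range (n + 1), ((-1) ^ i * pairCoeff q M n i +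
            (-1) ^ (i + 2) * pairCoeff q M n (i + 2)) * (z ^ (i + 1) - y ^ (i + 1)))) := by
          rw [ih, ← hrec, ← hS]; ring
      _ = _ := by
          rw [sum_range_succ' _ (n + 1), pairCoeff_zero, mul_zero, zero_mul, add_zero, mul_sum,
            mul_sum, ← sum_sub_distrib, mul_sum, mul_sum]
          refine sum_congr rfl fun i hi => ?_
          obtain ⟨d, hd⟩ := Nat.exists_eq_add_of_le (Nat.lt_succ_iff.mp (mem_range.mp hi))
          have h := pairCoeff_recurrence hq i d
          rw [← hd] at h
          linear_combination (-1) ^ i * (z ^ (i + 1) - y ^ (i + 1)) * h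

/-- The partial sums of `z ^ i - y ^ i`. -/
def pairSumPow (z y : R) (i : ℕ) : R := ∑ j ∈ range (i + 1), (z ^ j - y ^ j)

theorem sum_alternating_by_parts (s g : ℕ → R) (K : ℕ) :
    ∑ i ∈ range (K + 1), (-1) ^ i * g i * s i =
      ∑ i ∈ range (K + 1), (-1) ^ i * (g i + g (i + 1)) * ∑ j ∈ range (i + 1), s j -
        (-1) ^ K * g (K + 1) * ∑ j ∈ range (K + 1), s j := by
  induction K with
  | zero => simp; ring
  | succ K ih =>
    rw [sum_range_succ, ih, sum_range_succ _ (K + 1), sum_range_succ s (K + 1)]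
    ring

/-- Summation by parts cancels the prefactor 1 - q^(N+1), because adjacent coefficients add up to a
multiple of it: with i + d = N + 1, (1 - q^i)(1 - q^(2i+d+1)) + q^i (1 - q^(i+1))(1 - q^d) = (1 -
q^(i+d))(1 - q^(2i+1)). -/
theorem pairPoch_expansion' {q : R} {M : ℕ} (hq : q ^ M = 0) {z y : R} (hzy : z * y = 1) (N : ℕ) :
    (y - z) * pairPoch q z y N * tail q M (2 * N + 3) * tail q M 1 =
      ∑ i ∈ range (N + 2), (-1) ^ i * (q ^ i.choose 2 * (1 - q ^ (2 * i + 1)) *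
        tail q M (N + i + 3) * tail q M (N + 2 - i)) * pairSumPow z y i := by
  refine (isUnit_one_sub_pow hq (Nat.succ_ne_zero N)).mul_left_cancel ?_
  have h := pairPoch_expansion hq hzy N
  rw [sum_alternating_by_parts, pairCoeff_of_lt hq (Nat.lt_succ_self (N + 1)), mul_zero, zero_mul,
    sub_zero] at h
  simp only [← mul_assoc]
  rw [h, mul_sum]
  refine sum_congr rfl fun i hi => ?_
  obtain ⟨d, hd⟩ := Nat.exists_eq_add_of_le (Nat.lt_succ_iff.mp (mem_range.mp hi))
  rw [pairSumPow, pairCoeff, pairCoeff, choose_two_succ, hd,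
    show i + d + 1 - i = d + 1 by omega, show i + d + 1 - (i + 1) = d by omega,
    show N + i + 3 = 2 * i + d + 2 by omega, show N + 2 - i = d + 1 by omega,
    show i + d + i + 1 = 2 * i + d + 1 by ring, show i + d + (i + 1) + 1 = 2 * i + d + 2 by ring,
    show N.succ = i + d by omega, tail_step hq (2 * i + d + 1), tail_step hq d]
  ring

end NilpotentBase

/-! ### Theta expansions of the three series, and the Jacobi triple product -/

section NilpotentBase

variable {R : Type*} [CommRing R]

open Finset

theorem pairPoch_mul_poch {q : R} {M : ℕ} (hq : q ^ M = 0) (z y : R) (N : ℕ) :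
    pairPoch q z y N * (poch q M (z * q ^ (N + 1)) * poch q M (y * q ^ (N + 1))) =
      poch q M (z * q ^ 1) * poch q M (y * q ^ 1) := by
  induction N with
  | zero => simp [pairPoch]
  | succ N ih =>
    rw [← ih, pairPoch, prod_range_succ, ← pairPoch, poch_pow_succ hq z (N + 1),
      poch_pow_succ hq y (N + 1)]
    ring

/-- `cf n` is the inverse of `(z q^n, y q^n; q)_∞`. -/
def IsCrankFactor (q : R) (M : ℕ) (z y : R) (cf : ℕ → R) : Prop :=
  ∀ n, 1 ≤ n → poch q M (z * q ^ n) * poch q M (y * q ^ n) * cf n = 1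

/-- The product `(zq, yq; q)_∞` when `q ^ M = 0`. -/
def pairTail (q : R) (M : ℕ) (z y : R) : R := poch q M (z * q ^ 1) * poch q M (y * q ^ 1)

theorem pairTail_mul_crankFactor {q : R} {M : ℕ} (hq : q ^ M = 0) {z y : R} {cf : ℕ → R}
    (hcf : IsCrankFactor q M z y cf) (N : ℕ) :
    pairTail q M z y * cf (N + 1) = pairPoch q z y N := by
  rw [pairTail, ← pairPoch_mul_poch hq z y N, mul_assoc, hcf (N + 1) (by omega), mul_one]

theorem sum_range_shift {f : ℕ → R} {k M : ℕ} (h1 : ∀ n < k, f n = 0) (h2 : ∀ n, M ≤ n → f n = 0) :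
    ∑ n ∈ range M, f n = ∑ m ∈ range M, f (k + m) := by
  have e1 := sum_range_add f k M
  have e2 := sum_range_add f M k
  rw [sum_eq_zero fun n hn => h1 n (mem_range.mp hn), zero_add] at e1
  rw [sum_eq_zero (f := fun x => f (M + x)) fun n _ => h2 _ (Nat.le_add_right _ _), add_zero] at e2
  rw [← e1, ← e2, add_comm]

theorem sum_extend_range {f : ℕ → R} {m n : ℕ} (hmn : m ≤ n) (h : ∀ i, m ≤ i → f i = 0) :
    ∑ i ∈ range m, f i = ∑ i ∈ range n, f i :=
  sum_subset (range_subset_range.mpr hmn) fun i _ hi => h i (by simpa using hi)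

/-- Expansion of `∑ a_n (q^(2n+1))_∞ / (z q^n, y q^n)_∞`. -/
theorem pairTail_mul_sum {q : R} {M : ℕ} (hq : q ^ M = 0) {z y : R} (hzy : z * y = 1) {cf : ℕ → R}
    (hcf : IsCrankFactor q M z y cf) (a : ℕ → R) :
    (y - z) * pairTail q M z y * (∑ N ∈ range M, a (N + 1) * tail q M (2 * N + 3) * cf (N + 1)) *
        tail q M 1 =
      ∑ i ∈ range (M + 1), (-1) ^ i * pairSumPow z y i * (q ^ i.choose 2 * (1 - q ^ (2 * i + 1))) *
        ∑ N ∈ range M, a (N + 1) * tail q M (N + i + 3) * tail q M (N + 2 - i) := by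
  simp only [mul_sum, sum_mul]
  rw [sum_comm]
  refine sum_congr rfl fun N hN => ?_
  rw [mem_range] at hN
  have h := pairPoch_expansion' hq hzy N
  rw [sum_extend_range (show N + 2 ≤ M + 1 by omega) fun i hi => by
    rw [Nat.sub_eq_zero_of_le hi, tail_zero hq]; ring] at h
  calc _ = a (N + 1) * ((y - z) * pairPoch q z y N * tail q M (2 * N + 3) * tail q M 1) := by
        rw [← pairTail_mul_crankFactor hq hcf]; ring
    _ = _ := by
        rw [h, mul_sum]
        exact sum_congr rfl fun i _ => by ring

/-- Expansion of `∑ a_n (1 - q^n) (q^(2n+1))_∞ / (z q^n, y q^n)_∞`. -/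
theorem pairTail_mul_sum_one_sub {q : R} {M : ℕ} (hq : q ^ M = 0) {z y : R} (hzy : z * y = 1)
    {cf : ℕ → R} (hcf : IsCrankFactor q M z y cf) (a : ℕ → R) :
    (y - z) * pairTail q M z y * (∑ N ∈ range M, a (N + 1) * (1 - q ^ (N + 1)) *
        tail q M (2 * N + 3) * cf (N + 1)) * tail q M 1 =
      ∑ i ∈ range (M + 1), (-1) ^ i * (z ^ i - y ^ i) * (q ^ i.choose 2 * (1 - q ^ i)) *
        ∑ N ∈ range M, a (N + 1) * tail q M (N + i + 2) * tail q M (N + 2 - i) := by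
  simp only [mul_sum, sum_mul]
  rw [sum_comm]
  refine sum_congr rfl fun N hN => ?_
  rw [mem_range] at hN
  have h := pairPoch_expansion hq hzy N
  rw [sum_extend_range (show N + 2 ≤ M + 1 by omega) fun i hi => by
    rw [pairCoeff_of_lt hq (by omega)]; ring] at h
  calc _ = a (N + 1) * ((1 - q ^ (N + 1)) * (y - z) * pairPoch q z y N * tail q M (2 * N + 3) *
          tail q M 1) := by
        rw [← pairTail_mul_crankFactor hq hcf]; ring
    _ = _ := by
        rw [h, mul_sum]
        refine sum_congr rfl fun i _ => ?_
        rw [pairCoeff, show N + 1 + i + 1 = N + i + 2 by ring, show N + 1 + 1 - i = N + 2 - i by rfl]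
        ring

theorem tail_sub_of_lt {q : R} {M : ℕ} (hq : q ^ M = 0) {N k : ℕ} (h : N < k) :
    tail q M (N + 2 - (k + 1)) = 0 := by
  rw [Nat.sub_eq_zero_of_le (by omega), tail_zero hq]

/-- The inner sum of `pairTail_mul_sum` at i = k + 1. Terms with N < k vanish, their truncated index
being 0; putting N = k + m leaves Cauchy's sum with parameter 2i + 1. -/
theorem sum_durfee_shift {q : R} {M : ℕ} (hq : q ^ M = 0) (k : ℕ) :
    ∑ N ∈ range M, q ^ ((N + 1) ^ 2 + (N + 1)) * tail q M (N + (k + 1) + 3) *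
      tail q M (N + 2 - (k + 1)) = q ^ ((k + 1) ^ 2 + (k + 1)) * tail q M 1 := by
  rw [sum_range_shift (k := k) (fun N hN => by rw [tail_sub_of_lt hq hN, mul_zero])
    (fun N hN => by
      rw [pow_eq_zero_of_ge hq (show M ≤ (N + 1) ^ 2 + (N + 1) by nlinarith), zero_mul, zero_mul]),
    ← sum_durfee hq (2 * (k + 1) + 1), mul_sum]
  refine sum_congr rfl fun m _ => ?_
  rw [show k + m + 2 - (k + 1) = m + 1 by omega,
    show k + m + (k + 1) + 3 = m + (2 * (k + 1) + 1) + 1 by ring]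
  ring

theorem sum_durfee_shift' {q : R} {M : ℕ} (hq : q ^ M = 0) (k : ℕ) :
    ∑ N ∈ range M, q ^ (N + 1) ^ 2 * tail q M (N + (k + 1) + 2) *
      tail q M (N + 2 - (k + 1)) = q ^ (k + 1) ^ 2 * tail q M 1 := by
  rw [sum_range_shift (k := k) (fun N hN => by rw [tail_sub_of_lt hq hN, mul_zero])
    (fun N hN => by
      rw [pow_eq_zero_of_ge hq (show M ≤ (N + 1) ^ 2 by nlinarith), zero_mul, zero_mul]),
    ← sum_durfee hq (2 * (k + 1)), mul_sum]
  refine sum_congr rfl fun m _ => ?_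
  rw [show k + m + 2 - (k + 1) = m + 1 by omega,
    show k + m + (k + 1) + 2 = m + 2 * (k + 1) + 1 by ring]
  ring

theorem choose_two_add (m k : ℕ) :
    (k + m + 1).choose 2 = (m + 1).choose 2 + m * k + (k + 1).choose 2 := by
  induction k with
  | zero => simp
  | succ k ih =>
    rw [show k + 1 + m + 1 = k + m + 1 + 1 by ring, choose_two_succ, ih, choose_two_succ (k + 1)]
    ring

theorem sum_negPoch_shift {q : R} {M : ℕ} (hq : q ^ M = 0) (k : ℕ) :
    ∑ N ∈ range M, (q ^ (N + 2).choose 2 * negPoch q (N + 1)) * tail q M (N + (k + 1) + 3) *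
      tail q M (N + 2 - (k + 1)) = q ^ (k + 2).choose 2 * (negTail q M 1 * tail q M 1) := by
  rw [sum_range_shift (k := k) (fun N hN => by rw [tail_sub_of_lt hq hN, mul_zero])
    (fun N hN => by
      rw [pow_eq_zero_of_ge hq (show M ≤ (N + 2).choose 2 from
        hN.trans ((Nat.le_succ N).trans (le_choose_two_succ (N + 1)))), zero_mul, zero_mul,
        zero_mul]),
    ← sum_negPoch hq (k + 1), mul_sum]
  refine sum_congr rfl fun m _ => ?_
  rw [show k + m + 2 - (k + 1) = m + 1 by omega,
    show k + m + 2 = (k + 1) + m + 1 by ring, choose_two_add,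
    show k + m + (k + 1) + 3 = m + 2 * (k + 1) + 2 by ring,
    show k + m + 1 = m + (k + 1) by ring]
  ring

theorem pairSumPow_zero (z y : R) : pairSumPow z y 0 = 0 := by simp [pairSumPow]

theorem theta_A5 {q : R} {M : ℕ} (hq : q ^ M = 0) {z y : R} (hzy : z * y = 1) {cf : ℕ → R}
    (hcf : IsCrankFactor q M z y cf) :
    (y - z) * pairTail q M z y * (∑ N ∈ range M, q ^ ((N + 1) ^ 2 + (N + 1)) *
        tail q M (2 * N + 3) * cf (N + 1)) =
      ∑ i ∈ range (M + 1), (-1) ^ i * pairSumPow z y i *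
        (q ^ (i.choose 2 + i ^ 2 + i) - q ^ (i.choose 2 + i ^ 2 + 3 * i + 1)) := by
  refine (isUnit_tail hq one_ne_zero).mul_right_cancel ?_
  rw [pairTail_mul_sum hq hzy hcf (fun n => q ^ (n ^ 2 + n)), sum_mul]
  refine sum_congr rfl fun i _ => ?_
  -- The shifted sum formula needs i ≥ 1; at i = 0 the antisymmetric factor is zero.
  rcases i with _ | k
  · simp [pairSumPow_zero]
  · rw [sum_durfee_shift hq k]
    ring

/-- The difference S_A7 - S_A5 has the factor 1 - q^n in its summand, which is the prefactor of
`pairPoch_expansion`, so no summation by parts is needed. -/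
theorem theta_A7_sub_A5 {q : R} {M : ℕ} (hq : q ^ M = 0) {z y : R} (hzy : z * y = 1) {cf : ℕ → R}
    (hcf : IsCrankFactor q M z y cf) :
    (y - z) * pairTail q M z y * (∑ N ∈ range M, q ^ (N + 1) ^ 2 * (1 - q ^ (N + 1)) *
        tail q M (2 * N + 3) * cf (N + 1)) =
      ∑ i ∈ range (M + 1), (-1) ^ i * (z ^ i - y ^ i) *
        (q ^ (i.choose 2 + i ^ 2) - q ^ (i.choose 2 + i ^ 2 + i)) := by
  refine (isUnit_tail hq one_ne_zero).mul_right_cancel ?_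
  rw [pairTail_mul_sum_one_sub hq hzy hcf (fun n => q ^ n ^ 2), sum_mul]
  refine sum_congr rfl fun i _ => ?_
  rcases i with _ | k
  · simp
  · rw [sum_durfee_shift' hq k]
    ring

/-- The exponents are squares because C(i,2) + C(i+1,2) = i². The factor (-q)_∞ also appears on the
C5 side (`negTail_mul_map_SC5`) and is cancelled later. -/
theorem theta_C5 {q : R} {M : ℕ} (hq : q ^ M = 0) {z y : R} (hzy : z * y = 1) {cf : ℕ → R}
    (hcf : IsCrankFactor q M z y cf) :
    (y - z) * pairTail q M z y * (∑ N ∈ range M, q ^ (N + 2).choose 2 * negPoch q (N + 1) *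
        tail q M (2 * N + 3) * cf (N + 1)) =
      negTail q M 1 * ∑ i ∈ range (M + 1), (-1) ^ i * pairSumPow z y i *
        (q ^ i ^ 2 - q ^ (i + 1) ^ 2) := by
  refine (isUnit_tail hq one_ne_zero).mul_right_cancel ?_
  rw [pairTail_mul_sum hq hzy hcf (fun n => q ^ (n + 1).choose 2 * negPoch q n), mul_sum, sum_mul]
  refine sum_congr rfl fun i _ => ?_
  rcases i with _ | k
  · simp [pairSumPow_zero]
  · rw [sum_negPoch_shift hq k]
    have h2 : ∀ k : ℕ, k.choose 2 + (k + 1).choose 2 = k ^ 2 := fun k => by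
      induction k with
      | zero => rfl
      | succ k ih =>
        rw [choose_two_succ (k + 1), choose_two_succ k]; rw [choose_two_succ] at ih; linarith
    rw [← h2 (k + 1), show (k + 1 + 1) ^ 2 = (k + 1) ^ 2 + (2 * (k + 1) + 1) by ring, ← h2 (k + 1)]
    ring

theorem pairPoch_eq_pairTail {q : R} {M : ℕ} (hq : q ^ M = 0) (z y : R) {N : ℕ} (h : M ≤ N) :
    pairPoch q z y N = pairTail q M z y := by
  rw [pairTail, ← pairPoch_mul_poch hq z y N, poch_eq_one hq (by omega), poch_eq_one hq (by omega),
    mul_one, mul_one]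

/-- The Jacobi triple product identity. -/
theorem jacobi_triple_product {q : R} {M : ℕ} (hq : q ^ M = 0) {z y : R} (hzy : z * y = 1) :
    (y - z) * pairTail q M z y * tail q M 1 =
      ∑ i ∈ range (M + 1), (-1) ^ (i + 1) * (z ^ (i + 1) - y ^ (i + 1) + (z ^ i - y ^ i)) *
        q ^ (i + 1).choose 2 := by
  have hz : ∀ i, M + 1 ≤ i → q ^ i.choose 2 = 0 := fun i hi => by
    obtain ⟨j, rfl⟩ := Nat.exists_eq_add_of_le' (show 1 ≤ i by omega)
    exact pow_eq_zero_of_ge hq ((show M ≤ j by omega).trans (le_choose_two_succ j))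
  -- At N = 2M the finite product is complete, and every tail in a coefficient with i ≤ M equals 1.
  have h := pairPoch_expansion hq hzy (2 * M)
  rw [pow_eq_zero_of_ge hq (show M ≤ 2 * M + 1 by omega), pairPoch_eq_pairTail hq z y (by omega),
    tail_eq_one hq (show M ≤ 2 * (2 * M) + 3 by omega), sub_zero, one_mul, mul_one,
    ← sum_extend_range (show M + 1 ≤ 2 * M + 2 by omega) (fun i hi => by
      rw [pairCoeff, hz i hi]; ring)] at h
  have h2 : ∑ i ∈ range (M + 1), (-1) ^ i * pairCoeff q M (2 * M + 1) i * (z ^ i - y ^ i) =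
      ∑ i ∈ range (M + 1), (-1) ^ i * (z ^ i - y ^ i) * q ^ i.choose 2 -
        ∑ i ∈ range (M + 1), (-1) ^ i * (z ^ i - y ^ i) * q ^ (i + 1).choose 2 := by
    rw [← sum_sub_distrib]
    refine sum_congr rfl fun i hi => ?_
    rw [mem_range] at hi
    rw [pairCoeff, tail_eq_one hq (by omega), tail_eq_one hq (by omega), choose_two_succ]
    ring
  have h3 : ∑ i ∈ range (M + 1), (-1) ^ i * (z ^ i - y ^ i) * q ^ i.choose 2 =
      ∑ i ∈ range (M + 1), (-1) ^ (i + 1) * (z ^ (i + 1) - y ^ (i + 1)) * q ^ (i + 1).choose 2 := by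
    have := sum_range_succ' (fun i => (-1) ^ i * (z ^ i - y ^ i) * q ^ i.choose 2) (M + 1)
    rw [sum_range_succ, hz (M + 1) le_rfl] at this
    simpa using this
  rw [h, h2, h3, ← sum_sub_distrib]
  exact sum_congr rfl fun i _ => by ring

end NilpotentBase

/-! ### Odd-even factorizations, and the relation between spt_C1, C5 and spt -/

section NilpotentBase

variable {R : Type*} [CommRing R]

open Finset

/-- Descending induction from j ≥ M, where both products are trivial in the applications. -/
theorem eq_of_mul_step {A B c : ℕ → R} {M : ℕ} (hA : ∀ j, A j = c j * A (j + 1))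
    (hB : ∀ j, B j = c j * B (j + 1)) (h : ∀ j, M ≤ j → A j = B j) (j : ℕ) : A j = B j := by
  suffices ∀ d j, M ≤ j + d → A j = B j from this M j (Nat.le_add_left _ _)
  intro d
  induction d with
  | zero => exact fun j hj => h j hj
  | succ d ih => exact fun j hj => by rw [hA, hB, ih (j + 1) (by omega)]

theorem eq_of_isUnit_step {A B u : ℕ → R} {M : ℕ} (hu : ∀ j, IsUnit (u j))
    (hA : ∀ j, A (j + 1) = u j * A j) (hB : ∀ j, B (j + 1) = u j * B j)
    (h : ∀ j, M ≤ j → A j = B j) (j : ℕ) : A j = B j := by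
  suffices ∀ d j, M ≤ j + d → A j = B j from this M j (Nat.le_add_left _ _)
  intro d
  induction d with
  | zero => exact fun j hj => h j hj
  | succ d ih => exact fun j hj => (hu j).mul_left_cancel (by rw [← hA, ← hB, ih (j + 1) (by omega)])

theorem sq_pow_eq_zero {q : R} {M : ℕ} (hq : q ^ M = 0) : (q ^ 2) ^ M = 0 := by
  rw [← pow_mul, mul_comm, pow_mul, hq, zero_pow two_ne_zero]

/-- The product `(q^(2j+1); q²)_∞` when `q ^ M = 0`. -/
def oddTail (q : R) (M j : ℕ) : R := poch (q ^ 2) M (q * (q ^ 2) ^ j)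

/-- The product `(q^(2j); q²)_∞` when `q ^ M = 0`. -/
def evenTail (q : R) (M j : ℕ) : R := tail (q ^ 2) M j

/-- The finite product `(q; q)_n`. -/
def qFactorial (q : R) (n : ℕ) : R := ∏ i ∈ range n, (1 - q ^ (i + 1))

variable {q : R} {M : ℕ}

theorem oddTail_step (hq : q ^ M = 0) (j : ℕ) :
    oddTail q M j = (1 - q ^ (2 * j + 1)) * oddTail q M (j + 1) := by
  rw [oddTail, poch_pow_succ (sq_pow_eq_zero hq), oddTail]; ring

theorem oddTail_eq_one (hq : q ^ M = 0) {j : ℕ} (h : M ≤ j) : oddTail q M j = 1 :=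
  poch_eq_one (sq_pow_eq_zero hq) h _

theorem evenTail_step (hq : q ^ M = 0) (j : ℕ) :
    evenTail q M j = (1 - q ^ (2 * j)) * evenTail q M (j + 1) := by
  rw [evenTail, tail_step (sq_pow_eq_zero hq), evenTail, pow_mul]

theorem evenTail_eq_one (hq : q ^ M = 0) {j : ℕ} (h : M ≤ j) : evenTail q M j = 1 :=
  tail_eq_one (sq_pow_eq_zero hq) h

theorem isUnit_evenTail (hq : q ^ M = 0) {j : ℕ} (hj : j ≠ 0) : IsUnit (evenTail q M j) :=
  isUnit_tail (sq_pow_eq_zero hq) hj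

theorem tail_eq_oddTail_mul_evenTail (hq : q ^ M = 0) (j : ℕ) :
    tail q M (2 * j + 1) = oddTail q M j * evenTail q M (j + 1) := by
  refine eq_of_mul_step (A := fun j => tail q M (2 * j + 1))
    (B := fun j => oddTail q M j * evenTail q M (j + 1))
    (c := fun j => (1 - q ^ (2 * j + 1)) * (1 - q ^ (2 * j + 2))) (M := M) (fun j => ?_) (fun j => ?_)
    (fun j hj => ?_) j
  · rw [tail_step hq, tail_step hq (2 * j + 1 + 1)]; ring_nf
  · rw [oddTail_step hq, evenTail_step hq (j + 1)]; ring
  · rw [tail_eq_one hq (by omega), oddTail_eq_one hq hj, evenTail_eq_one hq (by omega), one_mul]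

theorem evenTail_eq_tail_mul_negTail (hq : q ^ M = 0) (j : ℕ) :
    evenTail q M j = tail q M j * negTail q M j := by
  refine eq_of_mul_step (A := fun j => evenTail q M j)
    (B := fun j => tail q M j * negTail q M j)
    (c := fun j => 1 - q ^ (2 * j)) (M := M) (evenTail_step hq) (fun j => ?_) (fun j hj => ?_) j
  · rw [tail_step hq, negTail_step hq]; ring
  · rw [tail_eq_one hq hj, negTail_eq_one hq hj, evenTail_eq_one hq hj, one_mul]

theorem tail_one_eq (hq : q ^ M = 0) : tail q M 1 = oddTail q M 0 * evenTail q M 1 := by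
  simpa using tail_eq_oddTail_mul_evenTail hq 0

/-- Euler's odd-distinct identity: (q)_∞ = (q;q²)_∞ (q²;q²)_∞ and (q²;q²)_∞ = (q)_∞ (-q)_∞, then
cancel (q)_∞. -/
theorem oddTail_mul_negTail (hq : q ^ M = 0) : oddTail q M 0 * negTail q M 1 = 1 := by
  refine (isUnit_tail hq one_ne_zero).mul_left_cancel ?_
  nth_rewrite 2 [tail_one_eq hq]
  rw [evenTail_eq_tail_mul_negTail hq]
  ring

theorem qFactorial_succ (q : R) (n : ℕ) :
    qFactorial q (n + 1) = qFactorial q n * (1 - q ^ (n + 1)) := prod_range_succ _ _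

theorem qFactorial_mul_tail (hq : q ^ M = 0) (n : ℕ) :
    qFactorial q n * tail q M (n + 1) = tail q M 1 := by
  induction n with
  | zero => simp [qFactorial]
  | succ n ih => rw [← ih, qFactorial_succ, tail_step hq (n + 1)]; ring

theorem qFactorial_eq_tail (hq : q ^ M = 0) {n : ℕ} (h : M ≤ n) : qFactorial q n = tail q M 1 := by
  rw [← qFactorial_mul_tail hq n, tail_eq_one hq (by omega), mul_one]

/-- Euler's identity `∑ q^(m(m+1)/2) / (q)_m = (-q)_∞`, times `(q)_∞`. -/
theorem sum_euler (hq : q ^ M = 0) :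
    ∑ m ∈ range M, q ^ (m + 1).choose 2 * tail q M (m + 1) = negTail q M 1 * tail q M 1 := by
  rcases Nat.eq_zero_or_pos M with rfl | hM
  · simpa using (Subsingleton.elim (h := subsingleton_of_zero_eq_one (by simpa using hq.symm)) _ _)
  -- Inserting the parameter j gives an expression independent of j; j = 0 is the claim, and at j =
  -- M only m = 0 survives.
  have key := eq_of_step (D := fun j => negPoch q j *
    ∑ m ∈ range M, q ^ ((m + 1).choose 2 + m * j) * tail q M (m + 1)) (K := M)
    (c := negTail q M 1 * tail q M 1) (fun j => ?_) ?_ 0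
  · simpa [negPoch] using key
  · rw [negPoch_succ, mul_assoc]
    congr 1
    rw [mul_sum, ← sub_eq_zero, ← sum_sub_distrib]
    have := sum_range_sub (fun m => q ^ ((m + 1).choose 2 + m * j) * tail q M m) M
    rw [tail_zero hq, pow_eq_zero_of_ge hq (show M ≤ (M + 1).choose 2 + M * j from
      (le_choose_two_succ M).trans (Nat.le_add_right _ _))] at this
    simp only [zero_mul, mul_zero, sub_zero] at this
    rw [← this]
    refine sum_congr rfl fun m _ => ?_
    rw [tail_step hq m, choose_two_succ (m + 1)]
    ring
  · have h := negPoch_mul_negTail hq M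
    rw [negTail_eq_one hq (show M ≤ M + 1 by omega), mul_one] at h
    rw [sum_eq_single 0, h]
    · simp
    · intro m _ hm
      rw [pow_eq_zero_of_ge hq (show M ≤ (m + 1).choose 2 + m * M by
        nlinarith [Nat.pos_of_ne_zero hm]), zero_mul]
    · intro h; simp at h; omega

/-- A case of Andrews' `q`-analogue of Gauss's second theorem. -/
theorem sum_gauss_second (hq : q ^ M = 0) (k : ℕ) :
    ∑ m ∈ range M, qFactorial q (2 * k + 1 + m) ^ 2 * q ^ (m + 1).choose 2 *
        oddTail q M (2 * k + 2 + m) * tail q M (m + 1) =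
      qFactorial (q ^ 2) k ^ 2 * oddTail q M 0 * tail q M 1 := by
  refine eq_of_isUnit_step (A := fun k => ∑ m ∈ range M, qFactorial q (2 * k + 1 + m) ^ 2 *
      q ^ (m + 1).choose 2 * oddTail q M (2 * k + 2 + m) * tail q M (m + 1))
    (B := fun k => qFactorial (q ^ 2) k ^ 2 * oddTail q M 0 * tail q M 1)
    (u := fun k => (1 - q ^ (2 * k + 2)) ^ 2) (M := M)
    (fun k => (isUnit_one_sub_pow hq (by omega)).pow 2) (fun k => ?_) (fun k => ?_)
    (fun k hk => ?_) k
  · rw [mul_sum, ← sub_eq_zero, ← sum_sub_distrib]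
    -- Certificate for A(k+1) - (1 - q^(2k+2))² A(k); its last factor is a quadratic polynomial in
    -- q^m.
    have := sum_range_sub (fun m => qFactorial q (2 * k + 1 + m) ^ 2 * q ^ (m + 1).choose 2 *
      oddTail q M (2 * k + 3 + m) * tail q M m * (-q ^ (2 * k + 2) * (2 - q ^ (2 * k + 2)) +
        (1 + q) * q ^ (2 * (2 * k + 2)) * q ^ m -
          q * q ^ (4 * (2 * k + 2)) * q ^ (2 * m))) M
    rw [tail_zero hq, pow_eq_zero_of_ge hq (le_choose_two_succ M)] at this
    simp only [zero_mul, mul_zero, sub_zero] at this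
    rw [← this]
    refine sum_congr rfl fun m _ => ?_
    rw [tail_step hq m, choose_two_succ (m + 1), show 2 * (k + 1) + 1 + m = 2 * k + 1 + m + 1 + 1 by ring,
      show 2 * k + 1 + (m + 1) = 2 * k + 1 + m + 1 by ring, qFactorial_succ q (2 * k + 1 + m + 1),
      qFactorial_succ q (2 * k + 1 + m), oddTail_step hq (2 * k + 2 + m),
      show 2 * k + 2 + m + 1 = 2 * k + 3 + m by ring, oddTail_step hq (2 * k + 3 + m),
      show 2 * (k + 1) + 2 + m = 2 * k + 3 + m + 1 by ring,
      show 2 * k + 3 + (m + 1) = 2 * k + 3 + m + 1 by ring]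
    ring
  · rw [qFactorial_succ]; ring
  -- For k ≥ M the factorials are (q)_∞ and the odd tails are 1, so only Euler's sum remains.
  · have h : ∀ m ∈ range M, qFactorial q (2 * k + 1 + m) ^ 2 * q ^ (m + 1).choose 2 *
        oddTail q M (2 * k + 2 + m) * tail q M (m + 1) =
        tail q M 1 ^ 2 * (q ^ (m + 1).choose 2 * tail q M (m + 1)) := fun m _ => by
      rw [qFactorial_eq_tail hq (by omega), oddTail_eq_one hq (by omega)]; ring
    rw [sum_congr rfl h, ← mul_sum, sum_euler hq, qFactorial_eq_tail (sq_pow_eq_zero hq) hk,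
      ← evenTail, evenTail_eq_tail_mul_negTail hq]
    linear_combination -(tail q M 1 ^ 3 * negTail q M 1) * oddTail_mul_negTail hq

/-- The summand of `1 / (q)_n = ∑ q^C(n-2k,2) / ((q)_(n-2k) (q²;q²)_k)`. -/
def eulerTerm (q : R) (M n k : ℕ) : R :=
  if 2 * k ≤ n then q ^ (n - 2 * k).choose 2 * tail q M (n - 2 * k + 1) * evenTail q M (k + 1) else 0

/-- With m = n + 1 - 2k, split 1 - q^(n+1) = (1 - q^m) + q^m (1 - q^(2k)): the first part lowers m,
the second lowers k. -/
theorem eulerTerm_recurrence (hq : q ^ M = 0) (n k : ℕ) : (1 - q ^ (n + 1)) * eulerTerm q M (n + 1) k =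
    q ^ (n - 2 * k) * eulerTerm q M n k +
      if k = 0 then 0 else (1 - q ^ (n - 2 * (k - 1))) * eulerTerm q M n (k - 1) := by
  rcases Nat.lt_or_ge (n + 1) (2 * k) with h | h
  · rw [eulerTerm, if_neg (by omega), eulerTerm, if_neg (by omega)]
    rcases Nat.lt_or_ge n (2 * (k - 1)) with h' | h'
    · simp [show eulerTerm q M n (k - 1) = 0 from if_neg (by omega)]
    · rw [show n - 2 * (k - 1) = 0 by omega]; simp
  obtain ⟨m, hm⟩ := Nat.exists_eq_add_of_le h
  have e1 : (1 - q ^ m) * (q ^ m.choose 2 * tail q M (m + 1) * evenTail q M (k + 1)) =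
      q ^ (n - 2 * k) * eulerTerm q M n k := by
    cases m with
    | zero => rw [eulerTerm, if_neg (by omega)]; simp
    | succ m =>
      rw [eulerTerm, if_pos (by omega), show n - 2 * k = m by omega, tail_step hq (m + 1),
        choose_two_succ]
      ring
  rw [← e1, eulerTerm, if_pos h, hm, show 2 * k + m - 2 * k = m by omega]
  cases k with
  | zero => simp
  | succ k =>
    rw [if_neg (by omega), show k + 1 - 1 = k by omega, eulerTerm, if_pos (by omega),
      show n - 2 * k = m + 1 by omega, evenTail_step hq (k + 1), tail_step hq (m + 1),
      choose_two_succ]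
    ring

/-- By induction on n: after reindexing, the k-th term receives the weights q^(n-2k) and 1 -
q^(n-2k), which add to 1. The bound on K makes the top boundary term vanish. -/
theorem tail_mul_evenTail (hq : q ^ M = 0) (n K : ℕ) (h : n < 2 * K) :
    tail q M (n + 1) * evenTail q M 1 = ∑ k ∈ range K, eulerTerm q M n k := by
  induction n generalizing K with
  | zero =>
    rw [sum_eq_single 0]
    · simp [eulerTerm]
    · intro k _ hk; rw [eulerTerm, if_neg (by omega)]
    · intro h'; simp at h'; omega
  | succ n ih =>
    refine (isUnit_one_sub_pow hq (Nat.succ_ne_zero n)).mul_left_cancel ?_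
    rw [← mul_assoc, ← tail_step hq, ih K (by omega), mul_sum]
    obtain ⟨L, rfl⟩ := Nat.exists_eq_add_of_le' (show 1 ≤ K by omega)
    have hL : (1 - q ^ (n - 2 * L)) * eulerTerm q M n L = 0 := by
      rcases Nat.lt_or_ge n (2 * L) with h' | h'
      · rw [eulerTerm, if_neg (by omega), mul_zero]
      · rw [show n - 2 * L = 0 by omega]; simp
    rw [sum_congr rfl fun k _ => eulerTerm_recurrence hq n k, sum_add_distrib, sum_range_succ' (fun k =>
      if k = 0 then 0 else (1 - q ^ (n - 2 * (k - 1))) * eulerTerm q M n (k - 1))]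
    simp only [Nat.add_eq_zero_iff, one_ne_zero, and_false, if_false, if_true, add_zero,
      Nat.add_sub_cancel]
    have := sum_range_succ (fun k => (1 - q ^ (n - 2 * k)) * eulerTerm q M n k) L
    rw [hL, add_zero] at this
    rw [← this, ← sum_add_distrib]
    exact sum_congr rfl fun k _ => by ring

/-- The relation between the generating functions of `spt_C1`, `spt_C5` and `spt`. -/
theorem sum_C1_eq (hq : q ^ M = 0) {cf ce : ℕ → R} (hcf : ∀ n, 1 ≤ n → tail q M n ^ 2 * cf n = 1)
    (hce : ∀ n, 1 ≤ n → evenTail q M n ^ 2 * ce n = 1) :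
    ∑ N ∈ range M, q ^ (N + 1) * oddTail q M (N + 1) * tail q M (N + 2) * cf (N + 1) =
      ∑ N ∈ range M, q ^ (N + 2).choose 2 * oddTail q M (N + 1) * tail q M (N + 2) * cf (N + 1) +
        ∑ k ∈ range M, q ^ (2 * (k + 1)) * evenTail q M (k + 2) * ce (k + 1) := by
  have hcf' : ∀ N, tail q M 1 ^ 2 * cf (N + 1) = qFactorial q N ^ 2 := fun N => by
    rw [← qFactorial_mul_tail hq N, mul_pow, mul_assoc, hcf (N + 1) (by omega), mul_one]
  have hce' : ∀ N, evenTail q M 1 ^ 2 * ce (N + 1) = qFactorial (q ^ 2) N ^ 2 := fun N => by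
    rw [evenTail, ← qFactorial_mul_tail (sq_pow_eq_zero hq) N, mul_pow, mul_assoc, ← evenTail,
      hce (N + 1) (by omega), mul_one]
  refine ((isUnit_evenTail hq one_ne_zero).mul
    ((isUnit_tail hq one_ne_zero).pow 2)).mul_left_cancel ?_
  -- Expand `tail q M (N + 2) * evenTail q M 1` by Euler terms and interchange sums: k = 0 yields
  -- the C5 series, and each k ≥ 1 is summed over N by `sum_gauss_second` into a term of the spt
  -- series in q².
  have e1 : evenTail q M 1 * tail q M 1 ^ 2 * ∑ N ∈ range M, q ^ (N + 1) * oddTail q M (N + 1) *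
        tail q M (N + 2) * cf (N + 1) =
      ∑ k ∈ range (M + 1), ∑ N ∈ range M, q ^ (N + 1) * oddTail q M (N + 1) * qFactorial q N ^ 2 *
        eulerTerm q M (N + 1) k := by
    rw [sum_comm, mul_sum]
    refine sum_congr rfl fun N hN => ?_
    rw [mem_range] at hN
    rw [← mul_sum, ← tail_mul_evenTail hq (N + 1) (M + 1) (by omega), ← hcf' N]
    ring
  have e2 : ∀ k, ∑ N ∈ range M, q ^ (N + 1) * oddTail q M (N + 1) * qFactorial q N ^ 2 *
        eulerTerm q M (N + 1) (k + 1) =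
      evenTail q M (k + 2) * q ^ (2 * (k + 1)) *
        (qFactorial (q ^ 2) k ^ 2 * oddTail q M 0 * tail q M 1) := fun k => by
    rw [sum_range_shift (k := 2 * k + 1)
      (fun N hN => by rw [eulerTerm, if_neg (by omega), mul_zero])
      (fun N hN => by rw [pow_eq_zero_of_ge hq (show M ≤ N + 1 by omega)]; ring),
      ← sum_gauss_second hq k, mul_sum]
    refine sum_congr rfl fun m _ => ?_
    rw [eulerTerm, if_pos (by omega), show 2 * k + 1 + m + 1 - 2 * (k + 1) = m by omega,
      show 2 * k + 1 + m + 1 = 2 * k + 2 + m by ring, choose_two_succ]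
    ring
  rw [e1, sum_range_succ', mul_add, mul_sum, mul_sum, add_comm]
  congr 1
  · refine sum_congr rfl fun N _ => ?_
    rw [eulerTerm, if_pos (by omega), ← hcf' N, choose_two_succ (N + 1)]
    simp only [mul_zero, Nat.sub_zero, zero_add]
    ring
  · refine sum_congr rfl fun k _ => ?_
    rw [e2, ← hce' k, tail_one_eq hq]
    ring

end NilpotentBase

/-! ### Passage from formal series to the rings A⟦X⟧/(X^M) -/

section Transfer

open Finset

variable {R : Type*} [CommRing R] {M : ℕ}

/-- A homomorphism killing X^M sees only the coefficients below M, so no continuity is required. -/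
theorem map_eq_of_coeff {A : Type*} [CommRing A] {φ : A⟦X⟧ →+* R} (hφ : φ PowerSeries.X ^ M = 0)
    {F G : A⟦X⟧} (h : ∀ N < M, PowerSeries.coeff N F = PowerSeries.coeff N G) : φ F = φ G := by
  have hdvd : PowerSeries.X ^ M ∣ F - G := PowerSeries.X_pow_dvd_iff.mpr fun N hN => by
    rw [map_sub, h N hN, sub_self]
  obtain ⟨H, hH⟩ := hdvd
  rw [← sub_eq_zero, ← map_sub, hH, map_mul, map_pow, hφ, zero_mul]

theorem map_qPochInf {ψ : ZQSeries →+* R} (hψ : ψ q ^ M = 0) (a : ZQSeries) {b : ℕ} (hb : 1 ≤ b) :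
    ψ (qPochInf a b) = poch (ψ q ^ b) M (ψ a) := by
  rw [map_eq_of_coeff hψ fun N hN => coeff_qPochInf a hb hN, map_prod, poch]
  exact prod_congr rfl fun j _ => by simp [pow_mul]

theorem map_qSum {ψ : ZQSeries →+* R} (hψ : ψ q ^ M = 0) {t : ℕ → ZQSeries}
    (ht : ∀ n, q ^ n ∣ t n) : ψ (qSum t) = ∑ N ∈ range M, ψ (t (N + 1)) := by
  rw [map_eq_of_coeff hψ fun N hN => coeff_qSum ht hN.le, map_sum, ← Finset.Ico_succ_right_eq_Icc,
    sum_Ico_eq_sum_range]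
  simp [add_comm]

theorem isCrankFactor_map {ψ : ZQSeries →+* R} (hψ : ψ q ^ M = 0) :
    IsCrankFactor (ψ q) M (ψ (z 1)) (ψ (z (-1))) fun n => ψ (crankFactor n) := by
  intro n hn
  have h := congrArg ψ (crankDenom_mul_crankFactor hn)
  rw [map_mul, crankDenom, map_mul, map_qPochInf hψ _ le_rfl, map_qPochInf hψ _ le_rfl,
    map_one] at h
  simpa using h

theorem map_SA5 {ψ : ZQSeries →+* R} (hψ : ψ q ^ M = 0) :
    ψ SA5 = ∑ N ∈ range M, ψ q ^ ((N + 1) ^ 2 + (N + 1)) * tail (ψ q) M (2 * N + 3) *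
      ψ (crankFactor (N + 1)) := by
  rw [SA5, map_qSum hψ fun n => Dvd.dvd.mul_right (Dvd.dvd.mul_right (pow_dvd_pow _ (by nlinarith)) _) _]
  refine sum_congr rfl fun N _ => ?_
  rw [map_mul, map_mul, map_qPochInf hψ _ le_rfl]
  simp [tail, mul_add]

theorem map_SA7 {ψ : ZQSeries →+* R} (hψ : ψ q ^ M = 0) :
    ψ SA7 = ∑ N ∈ range M, ψ q ^ (N + 1) ^ 2 * tail (ψ q) M (2 * N + 3) *
      ψ (crankFactor (N + 1)) := by
  rw [SA7, map_qSum hψ fun n => Dvd.dvd.mul_right (Dvd.dvd.mul_right (pow_dvd_pow _ (by nlinarith)) _) _]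
  refine sum_congr rfl fun N _ => ?_
  rw [map_mul, map_mul, map_qPochInf hψ _ le_rfl]
  simp [tail, mul_add]

theorem sq_add_div_two (n : ℕ) : (n ^ 2 + n) / 2 = (n + 1).choose 2 := by
  rw [Nat.choose_two_right, Nat.add_sub_cancel]; ring_nf

theorem map_SC5 {ψ : ZQSeries →+* R} (hψ : ψ q ^ M = 0) :
    ψ SC5 = ∑ N ∈ range M, ψ q ^ (N + 2).choose 2 * oddTail (ψ q) M (N + 1) *
      tail (ψ q) M (N + 2) * ψ (crankFactor (N + 1)) := by
  rw [SC5, map_qSum hψ fun n => Dvd.dvd.mul_right (Dvd.dvd.mul_right (pow_dvd_pow _ (by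
    rw [sq_add_div_two]; exact le_choose_two_succ n)) _) _]
  refine sum_congr rfl fun N _ => ?_
  rw [map_mul, map_mul, map_mul, map_qPochInf hψ _ le_rfl, map_qPochInf hψ _ one_le_two,
    sq_add_div_two, map_pow, map_pow, map_pow, oddTail, ← pow_mul, ← pow_succ', tail]
  simp only [pow_one]
  ring

/-- Since (-q)_∞ (q^(2n+1);q²)_∞ (q^(n+1))_∞ = (-q)_n (q^(2n+1))_∞, the C5 summand takes the shape
required by `pairTail_mul_sum`. -/
theorem negTail_mul_map_SC5 {ψ : ZQSeries →+* R} (hψ : ψ q ^ M = 0) :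
    negTail (ψ q) M 1 * ψ SC5 = ∑ N ∈ range M, ψ q ^ (N + 2).choose 2 * negPoch (ψ q) (N + 1) *
      tail (ψ q) M (2 * N + 3) * ψ (crankFactor (N + 1)) := by
  rw [map_SC5 hψ, mul_sum]
  refine sum_congr rfl fun N _ => ?_
  rw [← negPoch_mul_negTail hψ (N + 1), show 2 * N + 3 = 2 * (N + 1) + 1 by ring,
    tail_eq_oddTail_mul_evenTail hψ, evenTail_eq_tail_mul_negTail hψ]
  ring

/-- Evaluation at `z = u`. -/
noncomputable def evalZ {A : Type*} [CommRing A] (u : Aˣ) : ZQSeries →+* A⟦X⟧ :=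
  PowerSeries.map (LaurentPolynomial.eval₂ (Int.castRingHom A) u)

/-- Reduction of power series modulo `X ^ M`. -/
noncomputable def modXPow (A : Type*) [CommRing A] (M : ℕ) :
    A⟦X⟧ →+* A⟦X⟧ ⧸ Ideal.span {(PowerSeries.X : A⟦X⟧) ^ M} := Ideal.Quotient.mk _

variable {A : Type*} [CommRing A]

theorem modXPow_eq_iff {F G : A⟦X⟧} :
    modXPow A M F = modXPow A M G ↔ ∀ N < M, PowerSeries.coeff N F = PowerSeries.coeff N G := by
  rw [modXPow, Ideal.Quotient.eq, Ideal.mem_span_singleton, PowerSeries.X_pow_dvd_iff]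
  simp [sub_eq_zero]

theorem modXPow_X_pow : modXPow A M PowerSeries.X ^ M = 0 := by
  rw [← map_pow, ← map_zero (modXPow A M), modXPow_eq_iff]
  intro N hN
  simp [PowerSeries.coeff_X_pow, hN.ne]

@[simp] theorem evalZ_q (u : Aˣ) : evalZ u q = PowerSeries.X := by simp [evalZ, q]

@[simp] theorem evalZ_z (u : Aˣ) (m : ℤ) : evalZ u (z m) = PowerSeries.C ((u ^ m : Aˣ) : A) := by
  simp [evalZ, z, LaurentPolynomial.eval₂_T]

/-- Evaluation at `z = u`, modulo `q ^ M`. -/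
noncomputable def evalMod (u : Aˣ) (M : ℕ) :
    ZQSeries →+* A⟦X⟧ ⧸ Ideal.span {(PowerSeries.X : A⟦X⟧) ^ M} := (modXPow A M).comp (evalZ u)

theorem evalMod_q (u : Aˣ) : evalMod u M q = modXPow A M PowerSeries.X := by simp [evalMod]

theorem evalMod_q_pow (u : Aˣ) : evalMod u M q ^ M = 0 := by rw [evalMod_q, modXPow_X_pow]

theorem evalMod_z (u : Aˣ) (m : ℤ) :
    evalMod u M (z m) = modXPow A M (PowerSeries.C ((u ^ m : Aˣ) : A)) := by simp [evalMod]

end Transfer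

/-! ### Products at fifth roots of unity, and triangular numbers mod 5 -/

section FifthRoots

open Finset

/-- For a primitive fifth root of unity `w`, the product of `1 - w^a x` over all `a` is `1 - x^5`. -/
theorem prod_fifth_roots {R : Type*} [CommRing R] {w : R} (h : 1 + w + w ^ 2 + w ^ 3 + w ^ 4 = 0)
    (x : R) : (1 - w * x) * (1 - w ^ 4 * x) * ((1 - w ^ 2 * x) * (1 - w ^ 3 * x)) * (1 - x) =
      1 - x ^ 5 := by
  have h5 : w ^ 5 = 1 := by linear_combination (w - 1) * h
  have h1 : (w + w ^ 4) + (w ^ 2 + w ^ 3) = -1 := by linear_combination h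
  have h2 : (w + w ^ 4) * (w ^ 2 + w ^ 3) = -1 := by linear_combination h + (w + w ^ 2) * h5
  have h3 : (1 - w * x) * (1 - w ^ 4 * x) = 1 - (w + w ^ 4) * x + x ^ 2 := by
    linear_combination x ^ 2 * h5
  have h4 : (1 - w ^ 2 * x) * (1 - w ^ 3 * x) = 1 - (w ^ 2 + w ^ 3) * x + x ^ 2 := by
    linear_combination x ^ 2 * h5
  rw [h3, h4]
  linear_combination (-(x + x ^ 3) * h1 + x ^ 2 * h2) * (1 - x)

theorem pairTail_fifth_roots {R : Type*} [CommRing R] {w : R}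
    (h : 1 + w + w ^ 2 + w ^ 3 + w ^ 4 = 0) (q : R) (M : ℕ) :
    pairTail q M w (w ^ 4) * pairTail q M (w ^ 2) (w ^ 3) * tail q M 1 =
      ∏ j ∈ range M, (1 - q ^ (5 * (j + 1))) := by
  simp only [pairTail, tail, poch, ← prod_mul_distrib]
  refine prod_congr rfl fun j _ => ?_
  have := prod_fifth_roots h (q ^ (j + 1))
  rw [← pow_mul, mul_comm (j + 1) 5] at this
  rw [← this]
  ring

/-- If `E = 1 + O(q⁵)` is a series in `q⁵`, and `E F` has no terms with exponent `r` mod `5`, then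
neither has `F`. -/
theorem coeff_eq_zero_of_mul {A : Type*} [CommRing A] {E F : A⟦X⟧} {M r : ℕ}
    (hE0 : PowerSeries.coeff 0 E = 1) (hE : ∀ n, n % 5 ≠ 0 → PowerSeries.coeff n E = 0)
    (h : ∀ N < M, N % 5 = r → PowerSeries.coeff N (E * F) = 0) (N : ℕ) (hN : N < M)
    (hr : N % 5 = r) : PowerSeries.coeff N F = 0 := by
  induction N using Nat.strong_induction_on with
  | _ N ih =>
    have h1 := h N hN hr
    rw [PowerSeries.coeff_mul, sum_eq_single (0, N)] at h1
    · simpa [hE0] using h1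
    · rintro ⟨a, b⟩ hab hne
      rw [HasAntidiagonal.mem_antidiagonal] at hab
      dsimp only at hab ⊢
      by_cases ha : a % 5 = 0
      · have : a ≠ 0 := fun h0 => hne (by subst h0; simp_all)
        rw [ih b (by omega) (by omega) (by omega), mul_zero]
      · rw [hE a ha, zero_mul]
    · intro h'; simp at h'

theorem coeff_prod_one_sub {A : Type*} [CommRing A] (M : ℕ) :
    PowerSeries.coeff 0 (∏ j ∈ range M, (1 - (PowerSeries.X : A⟦X⟧) ^ (5 * (j + 1)))) = 1 ∧
      ∀ n, n % 5 ≠ 0 →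
        PowerSeries.coeff n (∏ j ∈ range M, (1 - (PowerSeries.X : A⟦X⟧) ^ (5 * (j + 1)))) = 0 := by
  induction M with
  | zero =>
    refine ⟨by simp, fun n hn => ?_⟩
    rw [prod_range_zero, PowerSeries.coeff_one, if_neg (by omega)]
  | succ M ih =>
    refine ⟨?_, fun n hn => ?_⟩
    · rw [prod_range_succ, mul_sub, mul_one, map_sub, ih.1, PowerSeries.coeff_mul_X_pow',
        if_neg (by omega), sub_zero]
    · rw [prod_range_succ, mul_sub, mul_one, map_sub, ih.2 n hn, PowerSeries.coeff_mul_X_pow']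
      split_ifs with h
      · rw [ih.2 _ (by omega), sub_zero]
      · rw [sub_zero]

theorem two_mul_choose_two (n : ℕ) : 2 * (n + 1).choose 2 = (n + 1) * n := by
  induction n with
  | zero => rfl
  | succ n ih => rw [choose_two_succ (n + 1), mul_add, ih]; ring

/-- Triangular numbers are 0, 1 or 3 mod 5, and 3 occurs only for i ≡ 2, exactly where the Jacobi
coefficient vanishes (`jacobi_coeff_eq_zero`). -/
theorem choose_two_mod_five (i : ℕ) (h : i % 5 ≠ 2) :
    (i + 1).choose 2 % 5 = 0 ∨ (i + 1).choose 2 % 5 = 1 := by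
  have h2 := two_mul_choose_two i
  obtain ⟨d, t, rfl⟩ : ∃ d t, i = 5 * t + d := ⟨i % 5, i / 5, (Nat.div_add_mod i 5).symm⟩
  have hd : 5 * t + d = 5 * (t + d / 5) + d % 5 := by omega
  have h4 : d % 5 < 5 := Nat.mod_lt _ (by norm_num)
  rw [hd] at h h2 ⊢
  generalize d % 5 = e at *
  generalize t + d / 5 = u at *
  generalize (5 * u + e + 1).choose 2 = c at *
  interval_cases e <;> ring_nf at h2 <;> omega

end FifthRoots

/-! ### Vanishing of coefficients at primitive fifth roots of unity -/

section Vanishing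

open Finset

theorem coeff_theta_mul_jacobi {A : Type*} [CommRing A] {a b : ℕ → A} {α α' β : ℕ → ℕ} {K L r : ℕ}
    (h : ∀ i j, b j = 0 ∨ (α i + β j) % 5 ≠ r ∧ (α' i + β j) % 5 ≠ r) {N : ℕ} (hN : N % 5 = r) :
    PowerSeries.coeff N ((∑ i ∈ range K, PowerSeries.C (a i) *
      ((PowerSeries.X : A⟦X⟧) ^ α i - PowerSeries.X ^ α' i)) *
        ∑ j ∈ range L, PowerSeries.C (b j) * (PowerSeries.X : A⟦X⟧) ^ β j) = 0 := by
  rw [sum_mul_sum, map_sum]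
  refine sum_eq_zero fun i _ => ?_
  rw [map_sum]
  refine sum_eq_zero fun j _ => ?_
  rcases h i j with h | ⟨h1, h2⟩
  · rw [h]; simp
  · rw [show PowerSeries.C (a i) * ((PowerSeries.X : A⟦X⟧) ^ α i - PowerSeries.X ^ α' i) *
      (PowerSeries.C (b j) * PowerSeries.X ^ β j) = PowerSeries.C (a i * b j) *
        (PowerSeries.X ^ (α i + β j) - PowerSeries.X ^ (α' i + β j)) by rw [map_mul]; ring,
      PowerSeries.coeff_C_mul, map_sub, PowerSeries.coeff_X_pow, PowerSeries.coeff_X_pow,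
      if_neg (by rintro rfl; exact h1 hN), if_neg (by rintro rfl; exact h2 hN), sub_zero, mul_zero]

variable {A : Type*} [CommRing A]

theorem jacobi_coeff_eq_zero {u : A} (h5 : u ^ 5 = 1) {j : ℕ} (hj : j % 5 = 2) :
    (-1) ^ (j + 1) * ((u ^ 2) ^ (j + 1) - (u ^ 3) ^ (j + 1) + ((u ^ 2) ^ j - (u ^ 3) ^ j)) = 0 := by
  obtain ⟨t, rfl⟩ : ∃ t, j = 5 * t + 2 := ⟨j / 5, by omega⟩
  have e1 : (u ^ 2) ^ (5 * t + 2 + 1) = u := by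
    rw [← pow_mul, show 2 * (5 * t + 2 + 1) = 5 * (2 * t + 1) + 1 by ring, pow_add, pow_mul, h5]
    simp
  have e2 : (u ^ 3) ^ (5 * t + 2 + 1) = u ^ 4 := by
    rw [← pow_mul, show 3 * (5 * t + 2 + 1) = 5 * (3 * t + 1) + 4 by ring, pow_add, pow_mul, h5]
    simp
  have e3 : (u ^ 2) ^ (5 * t + 2) = u ^ 4 := by
    rw [← pow_mul, show 2 * (5 * t + 2) = 5 * (2 * t) + 4 by ring, pow_add, pow_mul, h5]
    simp
  have e4 : (u ^ 3) ^ (5 * t + 2) = u := by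
    rw [← pow_mul, show 3 * (5 * t + 2) = 5 * (3 * t + 1) + 1 by ring, pow_add, pow_mul, h5]
    simp
  rw [e1, e2, e3, e4]
  ring

/-- If `S(ζ, q)` is a theta-like series divided by `(ζq, ζ⁻¹q; q)_∞` with `ζ` a primitive fifth root
of unity, then its coefficients vanish in the residue class that the exponents avoid. -/
theorem coeff_evalZ_eq_zero [IsDomain A] {u : Aˣ} (hu : 1 + (u : A) + u ^ 2 + u ^ 3 + u ^ 4 = 0)
    (hu' : ((u : A) ^ 4 - u) * ((u : A) ^ 3 - u ^ 2) ≠ 0) {S : ZQSeries} {r : ℕ} {a : ℕ → A}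
    {α α' : ℕ → ℕ}
    (hθ : ∀ M, (evalMod u M (z (-1)) - evalMod u M (z 1)) *
      pairTail (evalMod u M q) M (evalMod u M (z 1)) (evalMod u M (z (-1))) * evalMod u M S =
        ∑ i ∈ range (M + 1), modXPow A M (PowerSeries.C (a i)) *
          (evalMod u M q ^ α i - evalMod u M q ^ α' i))
    (hα : ∀ i, ∀ e < 2, (α i + e) % 5 ≠ r ∧ (α' i + e) % 5 ≠ r) {N : ℕ} (hN : N % 5 = r) :
    PowerSeries.coeff N (evalZ u S) = 0 := by
  have h5 : (u : A) ^ 5 = 1 := by linear_combination ((u : A) - 1) * hu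
  have hinv : ((u ^ (-1 : ℤ) : Aˣ) : A) = (u : A) ^ 4 := by
    rw [zpow_neg_one, Units.inv_eq_of_mul_eq_one_right]
    linear_combination h5
  set M := N + 1 with hM
  set w := modXPow A M (PowerSeries.C (u : A)) with hw
  set x := modXPow A M PowerSeries.X with hx
  have hw4 : 1 + w + w ^ 2 + w ^ 3 + w ^ 4 = 0 := by
    have := congrArg (fun t => modXPow A M (PowerSeries.C t)) hu
    simpa using this
  have hw5 : w ^ 2 * w ^ 3 = 1 := by linear_combination (w - 1) * hw4
  have hJ := jacobi_triple_product (q := x) (M := M) modXPow_X_pow hw5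
  have hT := hθ M
  rw [evalMod_q, evalMod_z, evalMod_z, hinv, zpow_one, map_pow, map_pow, ← hw, ← hx] at hT
  -- Product of the theta identity at z = u and the Jacobi identity at z = u². The scalar collects
  -- their factors 1/z - z, and the infinite products combine to (q⁵;q⁵)_∞.
  have key : modXPow A M (PowerSeries.C ((((u : A) ^ 4 - u) * ((u : A) ^ 3 - u ^ 2))) *
      ((∏ j ∈ range M, (1 - (PowerSeries.X : A⟦X⟧) ^ (5 * (j + 1)))) * evalZ u S)) =
      modXPow A M ((∑ i ∈ range (M + 1), PowerSeries.C (a i) *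
      ((PowerSeries.X : A⟦X⟧) ^ α i - PowerSeries.X ^ α' i)) *
        ∑ j ∈ range (M + 1), PowerSeries.C ((-1) ^ (j + 1) * (((u : A) ^ 2) ^ (j + 1) -
          ((u : A) ^ 3) ^ (j + 1) + (((u : A) ^ 2) ^ j - ((u : A) ^ 3) ^ j))) *
            (PowerSeries.X : A⟦X⟧) ^ (j + 1).choose 2) := by
    have hE := pairTail_fifth_roots hw4 x M
    simp only [map_mul, map_sum, map_sub, map_add, map_pow, map_prod, map_one, map_neg, ← hw, ← hx]
    rw [← hJ, ← hT, ← hE, evalMod, RingHom.comp_apply]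
    ring
  rw [modXPow_eq_iff] at key
  refine coeff_eq_zero_of_mul (M := M) (coeff_prod_one_sub M).1 (coeff_prod_one_sub M).2
    (fun n hn hr => ?_) N (Nat.lt_succ_self N) hN
  have h := key n hn
  rw [PowerSeries.coeff_C_mul, coeff_theta_mul_jacobi (r := r) (fun i j => ?_) hr] at h
  · exact (mul_eq_zero.mp h).resolve_left hu'
  · rcases eq_or_ne (j % 5) 2 with hj | hj
    · exact Or.inl (jacobi_coeff_eq_zero h5 hj)
    · right
      rcases choose_two_mod_five j hj with h' | h'
      · have := hα i 0 (by norm_num)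
        omega
      · have := hα i 1 (by norm_num)
        omega

theorem mod_five_cases {P : ℕ → Prop} (h : ∀ t, ∀ e < 5, P (5 * t + e)) (i : ℕ) : P i := by
  have := h (i / 5) (i % 5) (Nat.mod_lt _ (by norm_num))
  rwa [Nat.div_add_mod] at this

/-- The three forms are the exponents in the theta series of A5 and A7 - A5; `e` is the residue
contributed by the Jacobi series. -/
theorem theta_exponents (i e : ℕ) (he : e < 2) :
    ((i.choose 2 + i ^ 2 + e) % 5 ≠ 4 ∧ (i.choose 2 + i ^ 2 + i + e) % 5 ≠ 4) ∧
      (i.choose 2 + i ^ 2 + 3 * i + 1 + e) % 5 ≠ 4 := by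
  have h := two_mul_choose_two i
  rw [choose_two_succ] at h
  generalize i.choose 2 = c at *
  revert h
  refine mod_five_cases (P := fun i => 2 * (c + i) = (i + 1) * i →
    ((c + i ^ 2 + e) % 5 ≠ 4 ∧ (c + i ^ 2 + i + e) % 5 ≠ 4) ∧ (c + i ^ 2 + 3 * i + 1 + e) % 5 ≠ 4)
    (fun t d hd h => ?_) i
  interval_cases d <;> interval_cases e <;> ring_nf at h ⊢ <;> omega

theorem sq_exponents (i e : ℕ) (he : e < 2) : (i ^ 2 + e) % 5 ≠ 3 := by
  refine mod_five_cases (P := fun i => (i ^ 2 + e) % 5 ≠ 3) (fun t d hd => ?_) i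
  interval_cases d <;> interval_cases e <;> ring_nf <;> omega

theorem evalMod_z_mul (u : Aˣ) (M : ℕ) : evalMod u M (z 1) * evalMod u M (z (-1)) = 1 := by
  rw [evalMod_z, evalMod_z, ← map_mul, ← map_mul, ← Units.val_mul, ← zpow_add]
  simp

theorem modXPow_C_pairSumPow (u : Aˣ) (M i : ℕ) :
    modXPow A M (PowerSeries.C ((-1) ^ i * pairSumPow ((u ^ (1 : ℤ) : Aˣ) : A)
      ((u ^ (-1 : ℤ) : Aˣ) : A) i)) =
        (-1) ^ i * pairSumPow (evalMod u M (z 1)) (evalMod u M (z (-1))) i := by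
  simp only [evalMod_z, pairSumPow, map_mul, map_sum, map_sub, map_pow, map_neg, map_one]

theorem coeff_evalZ_SA5 [IsDomain A] {u : Aˣ} (hu : 1 + (u : A) + u ^ 2 + u ^ 3 + u ^ 4 = 0)
    (hu' : ((u : A) ^ 4 - u) * ((u : A) ^ 3 - u ^ 2) ≠ 0) {N : ℕ} (hN : N % 5 = 4) :
    PowerSeries.coeff N (evalZ u SA5) = 0 := by
  refine coeff_evalZ_eq_zero hu hu' (fun M => ?_)
    (fun i e he => ⟨(theta_exponents i e he).1.2, (theta_exponents i e he).2⟩) hN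
    (a := fun i => (-1) ^ i * pairSumPow ((u ^ (1 : ℤ) : Aˣ) : A) ((u ^ (-1 : ℤ) : Aˣ) : A) i)
  simp only [modXPow_C_pairSumPow]
  rw [map_SA5 (evalMod_q_pow u)]
  exact theta_A5 (evalMod_q_pow u) (evalMod_z_mul u M) (isCrankFactor_map (evalMod_q_pow u))

theorem coeff_evalZ_SA7 [IsDomain A] {u : Aˣ} (hu : 1 + (u : A) + u ^ 2 + u ^ 3 + u ^ 4 = 0)
    (hu' : ((u : A) ^ 4 - u) * ((u : A) ^ 3 - u ^ 2) ≠ 0) {N : ℕ} (hN : N % 5 = 4) :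
    PowerSeries.coeff N (evalZ u SA7) = 0 := by
  have h : PowerSeries.coeff N (evalZ u (SA7 - SA5)) = 0 := by
    refine coeff_evalZ_eq_zero hu hu' (fun M => ?_)
      (fun i e he => (theta_exponents i e he).1) hN
      (a := fun i => (-1) ^ i * (((u ^ (1 : ℤ) : Aˣ) : A) ^ i - ((u ^ (-1 : ℤ) : Aˣ) : A) ^ i))
    have h7 := theta_A7_sub_A5 (evalMod_q_pow u) (evalMod_z_mul u M)
      (isCrankFactor_map (evalMod_q_pow u))
    rw [map_sub, map_SA5 (evalMod_q_pow u), map_SA7 (evalMod_q_pow u), ← sum_sub_distrib]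
    simp only [map_mul, map_sub, map_pow, map_neg, map_one]
    simp only [← evalMod_z]
    rw [← h7]
    congr 1
    exact sum_congr rfl fun N _ => by ring
  rw [map_sub, map_sub, coeff_evalZ_SA5 hu hu' hN, sub_zero] at h
  exact h

theorem coeff_evalZ_SC5 [IsDomain A] {u : Aˣ} (hu : 1 + (u : A) + u ^ 2 + u ^ 3 + u ^ 4 = 0)
    (hu' : ((u : A) ^ 4 - u) * ((u : A) ^ 3 - u ^ 2) ≠ 0) {N : ℕ} (hN : N % 5 = 3) :
    PowerSeries.coeff N (evalZ u SC5) = 0 := by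
  refine coeff_evalZ_eq_zero hu hu' (fun M => ?_)
    (fun i e he => ⟨sq_exponents i e he, sq_exponents (i + 1) e he⟩) hN
    (a := fun i => (-1) ^ i * pairSumPow ((u ^ (1 : ℤ) : Aˣ) : A) ((u ^ (-1 : ℤ) : Aˣ) : A) i)
  simp only [modXPow_C_pairSumPow]
  refine (isUnit_negTail (evalMod_q_pow u) one_ne_zero).mul_left_cancel ?_
  rw [← theta_C5 (evalMod_q_pow u) (evalMod_z_mul u M) (isCrankFactor_map (evalMod_q_pow u)),
    ← negTail_mul_map_SC5 (evalMod_q_pow u)]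
  ring

end Vanishing

/-! ### From vanishing at ζ to equal residue counts -/

section Residues

open Finset

theorem eval₂_eq_sum {A : Type*} [CommRing A] (u : Aˣ) (p : ℤ[T;T⁻¹]) :
    LaurentPolynomial.eval₂ (Int.castRingHom A) u p =
      ∑ m ∈ p.coeff.support, (p.coeff m : A) * ((u ^ m : Aˣ) : A) := by
  conv_lhs => rw [← p.sum_coeff_single, Finsupp.sum, map_sum]
  refine sum_congr rfl fun m _ => ?_
  rw [LaurentPolynomial.single_eq_C_mul_T, LaurentPolynomial.eval₂_C_mul_T]
  rfl

/-- At a fifth root of unity, the coefficients of `S` are combinations of the residue counts. -/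
theorem coeff_evalZ_eq_sum {A : Type*} [CommRing A] {u : Aˣ} (hu : u ^ 5 = 1) (S : ZQSeries)
    (N : ℕ) : PowerSeries.coeff N (evalZ u S) =
      ∑ k ∈ range 5, (crankResidue S k 5 N : A) * (u : A) ^ k := by
  rw [evalZ, PowerSeries.coeff_map, eval₂_eq_sum, ← sum_fiberwise_of_maps_to (t := range 5)
    (g := fun m : ℤ => (m % 5).toNat) (fun m _ => by rw [mem_range]; omega)]
  refine sum_congr rfl fun k hk => ?_
  rw [mem_range] at hk
  have hf : ∀ m : ℤ, (m % 5).toNat = k ↔ m ≡ (k : ℤ) [ZMOD (5 : ℕ)] := fun m => by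
    rw [Int.ModEq]; omega
  rw [crankResidue, Int.cast_sum, sum_mul]
  refine sum_congr (filter_congr fun m _ => hf m) fun m hm => ?_
  have hm' : m % 5 = k := by
    have := (mem_filter.mp hm).2
    rw [Int.ModEq] at this; omega
  rw [crankCoeff]
  congr 1
  rw [← Units.val_pow_eq_pow_val, ← Int.mul_ediv_add_emod m 5, zpow_add, zpow_mul, hm']
  rw [show u ^ (5 : ℤ) = 1 from mod_cast hu, one_zpow, one_mul, zpow_natCast]

/-- Subtracting a 4 times 1 + ζ + ... + ζ⁴ = 0 leaves an integer polynomial of degree at most 3 with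
root ζ. It is divisible by the cyclotomic polynomial of degree 4, hence zero. -/
theorem eq_of_sum_fifth_root_eq_zero {ζ : ℂ} (hζ : IsPrimitiveRoot ζ 5) {a : ℕ → ℤ}
    (h : ∑ k ∈ range 5, (a k : ℂ) * ζ ^ k = 0) : ∀ k < 5, a k = a 4 := by
  have hc : ∑ k ∈ range 5, ζ ^ k = 0 := hζ.geom_sum_eq_zero (by norm_num)
  set P : Polynomial ℤ := ∑ k ∈ range 4, Polynomial.C (a k - a 4) * Polynomial.X ^ k with hP
  have hroot : Polynomial.aeval ζ P = 0 := by
    rw [hP, map_sum]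
    simp only [sum_range_succ, sum_range_zero] at h hc ⊢
    simp only [map_mul, map_pow, Polynomial.aeval_X, map_sub, eq_intCast, map_intCast]
    linear_combination h - (a 4 : ℂ) * hc
  have hmin := Polynomial.cyclotomic_eq_minpoly hζ (by norm_num)
  have hdvd : Polynomial.cyclotomic 5 ℤ ∣ P := by
    rw [hmin]
    exact minpoly.isIntegrallyClosed_dvd (hζ.isIntegral (by norm_num)) hroot
  have hP0 : P = 0 := by
    by_contra hne
    have h1 := Polynomial.natDegree_le_of_dvd hdvd hne
    rw [Polynomial.natDegree_cyclotomic, Nat.totient_prime (by norm_num)] at h1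
    have h2 : P.natDegree ≤ 3 := Polynomial.natDegree_sum_le_of_forall_le _ _ fun k hk =>
      (Polynomial.natDegree_C_mul_X_pow_le _ _).trans (by rw [mem_range] at hk; omega)
    omega
  intro k hk
  rcases Nat.lt_or_ge k 4 with h4 | h4
  · have := congrArg (fun Q => Polynomial.coeff Q k) hP0
    simp only [hP, Polynomial.finsetSum_coeff, Polynomial.coeff_C_mul, Polynomial.coeff_X_pow,
      Polynomial.coeff_zero, mul_ite, mul_one, mul_zero, sum_ite_eq, mem_range, h4, if_true] at this
    omega
  · rw [show k = 4 by omega]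

/-- If the coefficient of `q^N` in `S(ζ, q)` vanishes for all primitive fifth roots of unity, then
all the residue counts modulo `5` are a fifth of the coefficient in `S(1, q)`. -/
theorem five_mul_crankResidue {S : ZQSeries} {N : ℕ}
    (h : ∀ u : ℂˣ, 1 + (u : ℂ) + u ^ 2 + u ^ 3 + u ^ 4 = 0 →
      ((u : ℂ) ^ 4 - u) * ((u : ℂ) ^ 3 - u ^ 2) ≠ 0 → PowerSeries.coeff N (evalZ u S) = 0)
    {k : ℤ} (hk0 : 0 ≤ k) (hk5 : k < 5) :
    5 * crankResidue S k 5 N = PowerSeries.coeff N (evalZ (1 : ℤˣ) S) := by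
  obtain ⟨u, hζ⟩ : ∃ u : ℂˣ, IsPrimitiveRoot (u : ℂ) 5 := by
    have h := Complex.isPrimitiveRoot_exp 5 (by norm_num)
    exact ⟨Units.mk0 _ (h.ne_zero (by norm_num)), h⟩
  have hc : ∑ k ∈ range 5, (u : ℂ) ^ k = 0 := hζ.geom_sum_eq_zero (by norm_num)
  have h0 := h u (by simpa [sum_range_succ] using hc) (mul_ne_zero
    (sub_ne_zero.mpr fun he => by
      have := hζ.pow_inj (i := 4) (j := 1) (by norm_num) (by norm_num) (by simpa using he)
      omega)
    (sub_ne_zero.mpr fun he => by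
      have := hζ.pow_inj (i := 3) (j := 2) (by norm_num) (by norm_num) (by simpa using he)
      omega))
  rw [coeff_evalZ_eq_sum (Units.ext (by simpa using hζ.pow_eq_one))] at h0
  have heq := eq_of_sum_fifth_root_eq_zero hζ (a := fun k => crankResidue S k 5 N) h0
  rw [coeff_evalZ_eq_sum (one_pow 5)]
  lift k to ℕ using hk0
  have hk := heq k (by omega)
  have h1 := heq 0 (by omega)
  have h2 := heq 1 (by omega)
  have h3 := heq 2 (by omega)
  have h4 := heq 3 (by omega)
  simp only [sum_range_succ, sum_range_zero, Units.val_one, one_pow, mul_one, Int.cast_id] at *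
  linarith

end Residues

/-! ### Generating functions of partitions with a prescribed smallest part -/

section PartitionGenFun

open Finset

variable {R : Type*} [CommRing R] {M : ℕ}

open scoped PowerSeries.WithPiTopology in
theorem genFun_eq_prod {A : Type*} [CommSemiring A] {f : ℕ → ℕ → A} (M : ℕ)
    (hi : ∀ i c, M < i → f i c = 0) (hc : ∀ i c, M < c → f i c = 0) :
    Nat.Partition.genFun f = ∏ i ∈ range M, (1 + ∑ j ∈ range M,
        f (i + 1) (j + 1) • (PowerSeries.X : A⟦X⟧) ^ ((i + 1) * (j + 1))) := by
  -- Any topology serves to state the infinite product; all but finitely many factors are 1, so it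
  -- equals the finite product.
  let _ : TopologicalSpace A := ⊥
  have _ : DiscreteTopology A := ⟨rfl⟩
  have h1 := Nat.Partition.hasProd_genFun f
  have h2 : ∀ i, ∑' j, f (i + 1) (j + 1) • (PowerSeries.X : A⟦X⟧) ^ ((i + 1) * (j + 1)) =
      ∑ j ∈ range M, f (i + 1) (j + 1) • (PowerSeries.X : A⟦X⟧) ^ ((i + 1) * (j + 1)) := fun i =>
    tsum_eq_sum fun j hj => by rw [hc _ _ (by simp at hj; omega), zero_smul]
  simp only [h2] at h1
  refine h1.unique (hasProd_prod_of_ne_finset_one fun i hi' => ?_)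
  rw [sum_eq_zero fun j _ => by rw [hi _ _ (by simp at hi'; omega), zero_smul], add_zero]

theorem parts_le {n : ℕ} (p : n.Partition) {i : ℕ} (hi : i ∈ p.parts) : i ≤ n := by
  rw [← p.parts_sum]
  exact Multiset.le_sum_of_mem hi

theorem count_le {n : ℕ} (p : n.Partition) (i : ℕ) : p.parts.count i ≤ n := by
  refine (Multiset.count_le_card i p.parts).trans ?_
  have h := Multiset.card_nsmul_le_sum (s := p.parts) (a := 1) fun x hx => p.parts_pos hx
  simpa [p.parts_sum] using h

/-- The generating function of a weighted count of partitions as a finite product, when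
`q ^ M = 0`. -/
theorem map_genFun {φ : ℤ⟦X⟧ →+* R} (hφ : φ PowerSeries.X ^ M = 0) (f : ℕ → ℕ → ℤ) :
    φ (Nat.Partition.genFun f) = ∏ i ∈ range M, (1 + ∑ j ∈ range M,
      (f (i + 1) (j + 1) : R) * φ PowerSeries.X ^ ((i + 1) * (j + 1))) := by
  -- Parts and multiplicities of a partition of N < M are below M, so this truncation leaves the
  -- relevant coefficients unchanged.
  set g : ℕ → ℕ → ℤ := fun i c => if i ≤ M ∧ c ≤ M then f i c else 0 with hg
  rw [map_eq_of_coeff hφ (G := Nat.Partition.genFun g) fun N hN => ?_,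
    genFun_eq_prod M (fun i c h => if_neg (by omega)) (fun i c h => if_neg (by omega)), map_prod]
  · refine prod_congr rfl fun i hi => ?_
    rw [map_add, map_one, map_sum]
    congr 1
    refine sum_congr rfl fun j hj => ?_
    rw [mem_range] at hi hj
    rw [PowerSeries.smul_eq_C_mul, map_mul, map_pow, eq_intCast, map_intCast]
    simp only [show i + 1 ≤ M ∧ j + 1 ≤ M by omega, and_self, if_true]
  · rw [Nat.Partition.coeff_genFun, Nat.Partition.coeff_genFun]
    refine sum_congr rfl fun p _ => Finsupp.prod_congr fun i hi => ?_
    rw [Multiset.toFinsupp_support, Multiset.mem_toFinset] at hi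
    rw [Multiset.toFinsupp_apply, hg]
    have h1 := parts_le p hi
    have h2 := count_le p i
    simp only [show i ≤ M ∧ p.parts.count i ≤ M by omega, and_self, if_true]

theorem smallest_mem {n : ℕ} {p : n.Partition} (hp : p.parts ≠ 0) : smallest p ∈ p.parts :=
  Nat.sInf_mem (s := {i | i ∈ p.parts}) (Multiset.exists_mem_of_ne_zero hp)

theorem smallest_le {n : ℕ} {p : n.Partition} {i : ℕ} (hi : i ∈ p.parts) : smallest p ≤ i :=
  Nat.sInf_le hi

variable (w : ℕ → ℤ) (ok : ℕ → Prop) [DecidablePred ok]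

/-- The weight `w c` for `c` parts `s`, with only those larger parts that are `ok`. -/
def smallestChar (s i c : ℕ) : ℤ := if i = s then w c else if s < i ∧ ok i then 1 else 0

/-- The generating function of the partitions with smallest part `s`, whose other parts are `ok`,
weighted by `w` of the number of times that `s` appears. -/
noncomputable def smallestGenFun (s : ℕ) : ℤ⟦X⟧ :=
  Nat.Partition.genFun (smallestChar w ok s) - Nat.Partition.genFun (smallestChar 0 ok s)

/-- The weight of s enters only if s occurs. Partitions without s contribute equally to both
generating functions and cancel; those with s contribute to the first only. -/
theorem coeff_smallestGenFun (s n : ℕ) :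
    PowerSeries.coeff n (smallestGenFun w ok s) = ∑ p : n.Partition,
      if p.parts ≠ 0 ∧ smallest p = s ∧ ∀ i ∈ p.parts, i ≠ s → ok i then w (smallestCount p)
        else 0 := by
  rw [smallestGenFun, map_sub, Nat.Partition.coeff_genFun, Nat.Partition.coeff_genFun,
    ← sum_sub_distrib]
  refine sum_congr rfl fun p _ => ?_
  simp only [Finsupp.prod, Multiset.toFinsupp_support, Multiset.toFinsupp_apply]
  by_cases hgood : ∀ i ∈ p.parts, i = s ∨ s < i ∧ ok i
  · have hone : ∀ v : ℕ → ℤ, ∀ i ∈ p.parts, i ≠ s →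
        smallestChar v ok s i (p.parts.count i) = 1 := fun v i hi his => by
      rw [smallestChar, if_neg his, if_pos ((hgood i hi).resolve_left his)]
    by_cases hmem : s ∈ p.parts
    · have hne : p.parts ≠ 0 := fun h => by rw [h] at hmem; simp at hmem
      have hsm : smallest p = s := le_antisymm (smallest_le hmem) (by
        rcases hgood _ (smallest_mem hne) with h | h <;> omega)
      rw [if_pos ⟨hne, hsm, fun i hi his => ((hgood i hi).resolve_left his).2⟩]
      have hprod : ∀ v : ℕ → ℤ, ∏ i ∈ p.parts.toFinset, smallestChar v ok s i (p.parts.count i) =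
          v (p.parts.count s) := fun v => by
        rw [prod_eq_single s (fun i hi his => hone v i (Multiset.mem_toFinset.mp hi) his)
          (fun h => absurd (Multiset.mem_toFinset.mpr hmem) h), smallestChar, if_pos rfl]
      rw [hprod, hprod, smallestCount, hsm]
      simp
    · have hprod : ∀ v : ℕ → ℤ, ∏ i ∈ p.parts.toFinset, smallestChar v ok s i (p.parts.count i) =
          1 := fun v => prod_eq_one fun i hi => hone v i (Multiset.mem_toFinset.mp hi)
            fun his => hmem (his ▸ Multiset.mem_toFinset.mp hi)
      rw [hprod, hprod, sub_self, if_neg]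
      rintro ⟨hne, hsm, -⟩
      exact hmem (hsm ▸ smallest_mem hne)
  · have hneg : ¬ (p.parts ≠ 0 ∧ smallest p = s ∧ ∀ i ∈ p.parts, i ≠ s → ok i) := by
      rintro ⟨hne, hsm, hok⟩
      refine hgood fun i hi => ?_
      rcases eq_or_ne i s with h | h
      · exact Or.inl h
      · exact Or.inr ⟨lt_of_le_of_ne (hsm ▸ smallest_le hi) h.symm, hok i hi h⟩
    push Not at hgood
    obtain ⟨i, hi, his, hbad⟩ := hgood
    have hprod : ∀ v : ℕ → ℤ, ∏ i ∈ p.parts.toFinset, smallestChar v ok s i (p.parts.count i) =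
        0 := fun v => prod_eq_zero (Multiset.mem_toFinset.mpr hi) (by
          rw [smallestChar, if_neg his, if_neg fun h => hbad h.1 h.2])
    rw [hprod, hprod, sub_self, if_neg hneg]

theorem coeff_smallestGenFun_of_lt {s n : ℕ} (hn : n < s) :
    PowerSeries.coeff n (smallestGenFun w ok s) = 0 := by
  rw [coeff_smallestGenFun w ok]
  refine sum_eq_zero fun p _ => if_neg ?_
  rintro ⟨hne, hsm, -⟩
  have := parts_le p (smallest_mem hne)
  omega

/-- The product of the geometric series in `q^i` over the `i ≤ M` that are `ok`. -/
def okGeom (q : R) (M : ℕ) : R :=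
  ∏ i ∈ range M, if ok (i + 1) then ∑ j ∈ range (M + 1), q ^ ((i + 1) * j) else 1

/-- The product of `1 - q^i` over the `i ≤ M` that are `ok`. -/
def okProd (q : R) (M : ℕ) : R := ∏ i ∈ range M, if ok (i + 1) then 1 - q ^ (i + 1) else 1

theorem okProd_mul_okGeom {q : R} (hq : q ^ M = 0) : okProd ok q M * okGeom ok q M = 1 := by
  rw [okProd, okGeom, ← prod_mul_distrib]
  refine prod_eq_one fun i _ => ?_
  split_ifs
  · simp only [pow_mul]
    rw [mul_comm, geom_sum_mul_neg, ← pow_mul, pow_eq_zero_of_ge hq (by nlinarith), sub_zero]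
  · rw [one_mul]

theorem one_add_geom (q : R) (M i : ℕ) : 1 + ∑ j ∈ range M, q ^ (i * (j + 1)) =
    ∑ j ∈ range (M + 1), q ^ (i * j) := by
  rw [sum_range_succ']; simp [add_comm]

theorem map_smallestGenFun {φ : ℤ⟦X⟧ →+* R} (hφ : φ PowerSeries.X ^ M = 0) {s : ℕ} (hs : s < M) :
    φ (smallestGenFun w ok (s + 1)) =
      (∑ j ∈ range M, (w (j + 1) : R) * φ PowerSeries.X ^ ((s + 1) * (j + 1))) *
        okGeom (fun i => s + 1 < i ∧ ok i) (φ PowerSeries.X) M := by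
  have key : ∀ v : ℕ → ℤ, φ (Nat.Partition.genFun (smallestChar v ok (s + 1))) =
      (1 + ∑ j ∈ range M, (v (j + 1) : R) * φ PowerSeries.X ^ ((s + 1) * (j + 1))) *
        okGeom (fun i => s + 1 < i ∧ ok i) (φ PowerSeries.X) M := fun v => by
    rw [map_genFun hφ, okGeom, ← mul_prod_erase _ _ (mem_range.mpr hs),
      ← mul_prod_erase (range M) _ (mem_range.mpr hs), if_neg (by omega), one_mul]
    congr 1
    · simp [smallestChar]
    · refine prod_congr rfl fun i hi => ?_
      have his := ne_of_mem_erase hi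
      simp only [smallestChar, if_neg (show i + 1 ≠ s + 1 by omega)]
      split_ifs
      · simp only [Int.cast_one, one_mul, one_add_geom]
      · simp
  rw [smallestGenFun, map_sub, key, key]
  simp only [Pi.zero_apply, Int.cast_zero, zero_mul, sum_const_zero, add_zero, one_mul]
  ring

theorem map_genFun_ok {φ : ℤ⟦X⟧ →+* R} (hφ : φ PowerSeries.X ^ M = 0) :
    φ (Nat.Partition.genFun fun i _ => if ok i then 1 else 0) = okGeom ok (φ PowerSeries.X) M := by
  rw [map_genFun hφ, okGeom]
  refine prod_congr rfl fun i _ => ?_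
  split_ifs
  · simp only [Int.cast_one, one_mul, one_add_geom]
  · simp

/-- The sum over `s` of the coefficients of series divisible by `q^s`. -/
theorem map_mk_sum {φ : ℤ⟦X⟧ →+* R} (hφ : φ PowerSeries.X ^ M = 0) {G : ℕ → ℤ⟦X⟧} {c : ℕ → ℤ}
    (hc : ∀ n, c n = ∑ s ∈ range n, PowerSeries.coeff n (G (s + 1)))
    (hG : ∀ s n, n < s + 1 → PowerSeries.coeff n (G (s + 1)) = 0) :
    φ (PowerSeries.mk c) = ∑ s ∈ range M, φ (G (s + 1)) := by
  rw [← map_sum]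
  refine map_eq_of_coeff hφ fun N hN => ?_
  rw [PowerSeries.coeff_mk, hc, map_sum]
  exact sum_extend_range hN.le fun i hi => hG i N (by omega)

/-- This is Σ max(0, c - d) x^c = x^(d+1)/(1 - x)²; the excess d in multiplicity becomes the power
q^(s(d+1)) in the crank series. -/
theorem sum_mul_pow_eq {x : R} (hx : x ^ M = 0) (d : ℕ) :
    (1 - x) ^ 2 * ∑ j ∈ range M, (((j + 1 - d : ℕ) : ℤ) : R) * x ^ (j + 1) = x ^ (d + 1) := by
  have h : ∀ K : ℕ, (1 - x) ^ 2 * ∑ j ∈ range K, ((j : R) + 1) * x ^ (j + 1) =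
      x - (K + 1) * x ^ (K + 1) + K * x ^ (K + 2) := fun K => by
    induction K with
    | zero => simp
    | succ K ih => rw [sum_range_succ, mul_add, ih]; push_cast; ring
  rcases Nat.lt_or_ge d M with hd | hd
  · rw [sum_range_shift (k := d)
      (fun n hn => by rw [show n + 1 - d = 0 by omega]; simp)
      (fun n hn => by rw [pow_eq_zero_of_ge hx (by omega), mul_zero])]
    have h2 : ∀ m ∈ range M, (((d + m + 1 - d : ℕ) : ℤ) : R) * x ^ (d + m + 1) =
        x ^ d * (((m : R) + 1) * x ^ (m + 1)) := fun m _ => by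
      rw [show d + m + 1 - d = m + 1 by omega]; push_cast; ring
    rw [sum_congr rfl h2, ← mul_sum, mul_left_comm, h M, pow_eq_zero_of_ge hx (show M ≤ M + 1 by omega),
      pow_eq_zero_of_ge hx (show M ≤ M + 2 by omega)]
    ring
  · rw [sum_eq_zero fun j hj => by
      rw [mem_range] at hj
      rw [show j + 1 - d = 0 by omega]; simp, pow_eq_zero_of_ge hx (by omega), mul_zero]

theorem okProd_lt_eq_tail {q : R} (hq : q ^ M = 0) (s : ℕ) :
    okProd (fun i => s < i) q M = tail q M (s + 1) := by
  refine eq_of_mul_step (A := fun s => okProd (fun i => s < i) q M)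
    (B := fun s => tail q M (s + 1)) (c := fun s => 1 - q ^ (s + 1)) (M := M) (fun s => ?_)
    (fun s => tail_step hq (s + 1)) (fun s hs => ?_) s
  · rcases Nat.lt_or_ge s M with hs | hs
    · rw [okProd, okProd, ← mul_prod_erase _ _ (mem_range.mpr hs),
        ← mul_prod_erase (range M) _ (mem_range.mpr hs), if_pos (by omega), if_neg (by omega),
        one_mul]
      congr 1
      refine prod_congr rfl fun i hi => ?_
      have := ne_of_mem_erase hi
      simp only [show s < i + 1 ↔ s + 1 < i + 1 by omega]
    · rw [pow_eq_zero_of_ge hq (show M ≤ s + 1 by omega), sub_zero, one_mul, okProd, okProd]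
      refine prod_congr rfl fun i hi => ?_
      rw [mem_range] at hi
      rw [if_neg (by omega), if_neg (by omega)]
  · rw [tail_eq_one hq (by omega), okProd]
    refine prod_eq_one fun i hi => ?_
    rw [mem_range] at hi
    rw [if_neg (by omega)]

theorem okProd_mul_okProd (ok₁ ok₂ ok₃ : ℕ → Prop) [DecidablePred ok₁] [DecidablePred ok₂]
    [DecidablePred ok₃] (h : ∀ i, ok₃ i ↔ ok₁ i ∨ ok₂ i) (hd : ∀ i, ¬ (ok₁ i ∧ ok₂ i)) (q : R) :
    okProd ok₁ q M * okProd ok₂ q M = okProd ok₃ q M := by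
  rw [okProd, okProd, okProd, ← prod_mul_distrib]
  refine prod_congr rfl fun i _ => ?_
  have h1 := h (i + 1)
  have h2 := hd (i + 1)
  by_cases h3 : ok₁ (i + 1) <;> by_cases h4 : ok₂ (i + 1) <;> simp_all

theorem okProd_odd {q : R} (hq : q ^ M = 0) (s : ℕ) :
    okProd (fun i => Odd i ∧ 2 * s ≤ i) q M = oddTail q M s := by
  rw [oddTail, poch]
  -- The range is enlarged to contain every index 2(s + j) with j < M; the added factors are 1.
  have h1 : okProd (fun i => Odd i ∧ 2 * s ≤ i) q M = ∏ i ∈ range (2 * (s + M) + M),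
      if Odd (i + 1) ∧ 2 * s ≤ i + 1 then 1 - q ^ (i + 1) else 1 := by
    refine prod_subset (range_subset_range.mpr (by omega)) fun i _ hi => ?_
    rw [pow_eq_zero_of_ge hq (show M ≤ i + 1 by simp at hi; omega), sub_zero, ite_self]
  rw [h1]
  symm
  refine prod_of_injOn (fun j => 2 * (s + j)) (fun a _ b _ h => by simp only at h; omega)
    (fun j hj => by simp at hj ⊢; omega) (fun i _ hi => ?_) (fun j _ => ?_)
  · split_ifs with h
    · obtain ⟨⟨t, ht⟩, h⟩ := h
      have : M ≤ t - s := by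
        by_contra hlt
        exact hi ⟨t - s, by simp; omega, by simp only; omega⟩
      rw [pow_eq_zero_of_ge hq (by omega), sub_zero]
    · rfl
  · rw [if_pos ⟨⟨s + j, rfl⟩, by omega⟩]
    ring

end PartitionGenFun

/-! ### The series at z = 1 as generating functions of the spt functions -/

section GeneratingFunctions

open Finset

variable {R : Type*} [CommRing R] {M : ℕ}

theorem okProd_congr {ok₁ ok₂ : ℕ → Prop} [DecidablePred ok₁] [DecidablePred ok₂]
    (h : ∀ i, ok₁ i ↔ ok₂ i) (q : R) : okProd ok₁ q M = okProd ok₂ q M := by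
  simp only [okProd, h]

/-- The weight `max(0, c - d)` of `c` appearances of the smallest part. -/
def excess (d c : ℕ) : ℤ := ((c - d : ℕ) : ℤ)

theorem map_smallestGenFun_excess {φ : ℤ⟦X⟧ →+* R} (hφ : φ PowerSeries.X ^ M = 0) (ok : ℕ → Prop)
    [DecidablePred ok] (d : ℕ) {s : ℕ} (hs : s < M) :
    (1 - φ PowerSeries.X ^ (s + 1)) ^ 2 * okProd (fun i => s + 1 < i ∧ ok i) (φ PowerSeries.X) M *
      φ (smallestGenFun (excess d) ok (s + 1)) = φ PowerSeries.X ^ ((s + 1) * (d + 1)) := by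
  have h1 := okProd_mul_okGeom (fun i => s + 1 < i ∧ ok i) hφ
  have h2 := sum_mul_pow_eq (x := φ PowerSeries.X ^ (s + 1)) (M := M)
    (by rw [← pow_mul]; exact pow_eq_zero_of_ge hφ (by nlinarith)) d
  rw [map_smallestGenFun _ _ hφ hs, pow_mul, ← h2]
  simp only [excess, pow_mul]
  linear_combination ((1 - φ PowerSeries.X ^ (s + 1)) ^ 2 * ∑ j ∈ range M,
    (((j + 1 - d : ℕ) : ℤ) : R) * (φ PowerSeries.X ^ (s + 1)) ^ (j + 1)) * h1

/-- With smallest part s, π₁ gives q^(s(d+1)) / ((1 - q^s)² (q^(s+1))_∞) and π₂ gives (q^(2s+1))_∞ /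
(q^(s+1))_∞; together the denominator is (q^s)_∞². -/
theorem map_pair_term {φ : ℤ⟦X⟧ →+* R} (hφ : φ PowerSeries.X ^ M = 0) {cf : ℕ → R}
    (hcf : ∀ n, 1 ≤ n → tail (φ PowerSeries.X) M n ^ 2 * cf n = 1) (d : ℕ) {s : ℕ} (hs : s < M) :
    φ (smallestGenFun (excess d) (fun _ => True) (s + 1) *
      Nat.Partition.genFun fun i _ => if s + 1 < i ∧ i ≤ 2 * (s + 1) then 1 else 0) =
      φ PowerSeries.X ^ ((s + 1) * (d + 1)) * tail (φ PowerSeries.X) M (2 * s + 3) * cf (s + 1) := by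
  set x := φ PowerSeries.X with hx
  have h1 := map_smallestGenFun_excess hφ (fun _ => True) d hs
  have h2 := okProd_mul_okGeom (fun i => s + 1 < i ∧ i ≤ 2 * (s + 1)) hφ
  have h3 := okProd_mul_okProd (M := M) (fun i => s + 1 < i ∧ i ≤ 2 * (s + 1))
    (fun i => 2 * (s + 1) < i) (fun i => s + 1 < i) (fun i => by omega) (fun i => by omega) x
  rw [okProd_congr (ok₂ := fun i => s + 1 < i) (by simp), ← hx, okProd_lt_eq_tail hφ] at h1
  rw [okProd_lt_eq_tail hφ, okProd_lt_eq_tail hφ, show 2 * (s + 1) + 1 = 2 * s + 3 by ring] at h3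
  rw [map_mul, map_genFun_ok _ hφ, ← hx]
  refine ((isUnit_tail hφ (Nat.succ_ne_zero s)).pow 2).mul_left_cancel ?_
  have h4 := hcf (s + 1) (by omega)
  have h5 := tail_step hφ (s + 1)
  calc _ = ((1 - x ^ (s + 1)) ^ 2 * tail x M (s + 1 + 1) * φ (smallestGenFun (excess d)
        (fun _ => True) (s + 1))) * (tail x M (s + 1 + 1) *
          okGeom (fun i => s + 1 < i ∧ i ≤ 2 * (s + 1)) x M) := by rw [Nat.succ_eq_add_one, h5]; ring
    _ = x ^ ((s + 1) * (d + 1)) * tail x M (2 * s + 3) := by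
        rw [h1, ← h3]
        linear_combination x ^ ((s + 1) * (d + 1)) * tail x M (2 * s + 3) * h2
    _ = _ := by
        linear_combination -(x ^ ((s + 1) * (d + 1)) * tail x M (2 * s + 3)) * h4

theorem map_spt_term {φ : ℤ⟦X⟧ →+* R} (hφ : φ PowerSeries.X ^ M = 0) {cf : ℕ → R}
    (hcf : ∀ n, 1 ≤ n → tail (φ PowerSeries.X) M n ^ 2 * cf n = 1) {s : ℕ} (hs : s < M) :
    φ (smallestGenFun (excess 0) (fun _ => True) (s + 1)) =
      φ PowerSeries.X ^ (s + 1) * tail (φ PowerSeries.X) M (s + 2) * cf (s + 1) := by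
  set x := φ PowerSeries.X with hx
  have h1 := map_smallestGenFun_excess hφ (fun _ => True) 0 hs
  rw [okProd_congr (ok₂ := fun i => s + 1 < i) (by simp), ← hx, okProd_lt_eq_tail hφ, zero_add,
    mul_one] at h1
  refine ((isUnit_tail hφ (Nat.succ_ne_zero s)).pow 2).mul_left_cancel ?_
  have h4 := hcf (s + 1) (by omega)
  have h5 := tail_step hφ (s + 1)
  calc _ = ((1 - x ^ (s + 1)) ^ 2 * tail x M (s + 1 + 1) * φ (smallestGenFun (excess 0)
        (fun _ => True) (s + 1))) * tail x M (s + 1 + 1) := by rw [Nat.succ_eq_add_one, h5]; ring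
    _ = x ^ (s + 1) * tail x M (s + 2) := by rw [h1]
    _ = _ := by linear_combination -(x ^ (s + 1) * tail x M (s + 2)) * h4

/-- Excluding the odd parts from 2s on multiplies the spt term by (q^(2s+1);q²)_∞. -/
theorem map_sptC1_term {φ : ℤ⟦X⟧ →+* R} (hφ : φ PowerSeries.X ^ M = 0) {cf : ℕ → R}
    (hcf : ∀ n, 1 ≤ n → tail (φ PowerSeries.X) M n ^ 2 * cf n = 1) {s : ℕ} (hs : s < M) :
    φ (smallestGenFun (excess 0) (fun i => Odd i → i < 2 * (s + 1)) (s + 1)) =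
      φ PowerSeries.X ^ (s + 1) * oddTail (φ PowerSeries.X) M (s + 1) *
        tail (φ PowerSeries.X) M (s + 2) * cf (s + 1) := by
  set x := φ PowerSeries.X with hx
  have h1 := map_smallestGenFun_excess hφ (fun i => Odd i → i < 2 * (s + 1)) 0 hs
  rw [← hx, zero_add, mul_one] at h1
  have h3 := okProd_mul_okProd (M := M) (fun i => s + 1 < i ∧ (Odd i → i < 2 * (s + 1)))
    (fun i => Odd i ∧ 2 * (s + 1) ≤ i) (fun i => s + 1 < i)
    (fun i => by by_cases h : Odd i <;> simp [h]; omega)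
    (fun i => by rintro ⟨⟨-, h⟩, ho, h'⟩; have := h ho; omega) x
  rw [okProd_lt_eq_tail hφ, okProd_odd hφ] at h3
  refine ((isUnit_tail hφ (Nat.succ_ne_zero s)).pow 2).mul_left_cancel ?_
  have h4 := hcf (s + 1) (by omega)
  have h5 := tail_step hφ (s + 1)
  calc _ = ((1 - x ^ (s + 1)) ^ 2 * okProd (fun i => s + 1 < i ∧ (Odd i → i < 2 * (s + 1))) x M *
        φ (smallestGenFun (excess 0) (fun i => Odd i → i < 2 * (s + 1)) (s + 1))) *
          (oddTail x M (s + 1) * tail x M (s + 1 + 1)) := by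
        rw [Nat.succ_eq_add_one, h5]
        linear_combination -(1 - x ^ (s + 1)) ^ 2 * tail x M (s + 1 + 1) *
          φ (smallestGenFun (excess 0) (fun i => Odd i → i < 2 * (s + 1)) (s + 1)) * h3
    _ = x ^ (s + 1) * oddTail x M (s + 1) * tail x M (s + 2) := by rw [h1]; ring
    _ = _ := by linear_combination -(x ^ (s + 1) * oddTail x M (s + 1) * tail x M (s + 2)) * h4

theorem smallest_pos {n : ℕ} {p : n.Partition} (hp : p.parts ≠ 0) : 0 < smallest p :=
  p.parts_pos (smallest_mem hp)

/-- A sum over the possible smallest parts picks out the smallest part. -/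
theorem sum_smallest_eq {n a : ℕ} (han : a ≤ n) (p : a.Partition) (g : ℕ → ℤ) :
    ∑ s ∈ range n, (if p.parts ≠ 0 ∧ smallest p = s + 1 then g (s + 1) else 0) =
      if p.parts ≠ 0 then g (smallest p) else 0 := by
  split_ifs with hp
  · have h1 := smallest_pos hp
    have h2 := parts_le p (smallest_mem hp)
    rw [sum_eq_single (smallest p - 1)]
    · rw [show smallest p - 1 + 1 = smallest p by omega, if_pos ⟨hp, rfl⟩]
    · intro s _ hs
      rw [if_neg]
      rintro ⟨-, h⟩
      omega
    · intro h
      rw [mem_range] at h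
      omega
  · exact sum_eq_zero fun s _ => if_neg fun h => hp h.1

theorem smallestCount_of_parts_eq_zero {n : ℕ} {p : n.Partition} (hp : p.parts = 0) :
    smallestCount p = 0 := by simp [smallestCount, hp]

theorem sum_coeff_smallestGenFun (d : ℕ → ℕ) (ok : ℕ → ℕ → Prop) [∀ s, DecidablePred (ok s)]
    (n : ℕ) : ∑ s ∈ range n, PowerSeries.coeff n (smallestGenFun (excess (d (s + 1))) (ok (s + 1))
      (s + 1)) = ∑ p : n.Partition, if p.parts ≠ 0 ∧ ∀ i ∈ p.parts, i ≠ smallest p →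
        ok (smallest p) i then excess (d (smallest p)) (smallestCount p) else 0 := by
  simp only [coeff_smallestGenFun]
  rw [sum_comm]
  refine sum_congr rfl fun p _ => ?_
  have h := sum_smallest_eq le_rfl p fun s => if ∀ i ∈ p.parts, i ≠ s → ok s i then
    excess (d s) (smallestCount p) else 0
  simp only [← ite_and] at h
  rw [← h]
  exact sum_congr rfl fun s _ => by simp only [and_assoc]

theorem spt_eq_sum (n : ℕ) : (spt n : ℤ) = ∑ s ∈ range n,
    PowerSeries.coeff n (smallestGenFun (excess 0) (fun _ => True) (s + 1)) := by
  have h := sum_coeff_smallestGenFun (fun _ => 0) (fun _ _ => True) n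
  rw [h, spt, Nat.cast_sum]
  refine sum_congr rfl fun p _ => ?_
  by_cases hp : p.parts = 0
  · simp [hp, smallestCount_of_parts_eq_zero hp]
  · simp [hp, excess]

theorem sptC1_eq_sum (n : ℕ) : (sptC1 n : ℤ) = ∑ s ∈ range n, PowerSeries.coeff n
    (smallestGenFun (excess 0) (fun i => Odd i → i < 2 * (s + 1)) (s + 1)) := by
  have h := sum_coeff_smallestGenFun (fun _ => 0) (fun s i => Odd i → i < 2 * s) n
  rw [h, sptC1, Nat.cast_sum, sum_filter]
  refine sum_congr rfl fun p _ => ?_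
  by_cases hp : p.parts = 0
  · simp [hp, smallestCount_of_parts_eq_zero hp]
  · have h1 := smallest_pos hp
    have h2 : (∀ i ∈ p.parts, i ≠ smallest p → Odd i → i < 2 * smallest p) ↔
        ∀ i ∈ p.parts, Odd i → i < 2 * smallest p :=
      ⟨fun h i hi ho => by
        rcases eq_or_ne i (smallest p) with he | he
        · omega
        · exact h i hi he ho, fun h i hi _ ho => h i hi ho⟩
    simp only [h2, ne_eq, hp, not_false_eq_true, true_and, excess, Nat.sub_zero]

theorem coeff_genFun_ok (ok : ℕ → Prop) [DecidablePred ok] (n : ℕ) :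
    PowerSeries.coeff n (Nat.Partition.genFun fun i _ => if ok i then (1 : ℤ) else 0) =
      ∑ p : n.Partition, if ∀ i ∈ p.parts, ok i then 1 else 0 := by
  rw [Nat.Partition.coeff_genFun]
  refine sum_congr rfl fun p _ => ?_
  rw [Finsupp.prod, Multiset.toFinsupp_support, prod_ite_zero, prod_const_one]
  simp

theorem pairSum_eq_sum (d : ℕ → ℕ) (n : ℕ) :
    (pairSum (fun _ π₁ => smallestCount π₁ - d (smallest π₁)) n : ℤ) = ∑ s ∈ range n,
      PowerSeries.coeff n (smallestGenFun (excess (d (s + 1))) (fun _ => True) (s + 1) *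
        Nat.Partition.genFun fun i _ => if s + 1 < i ∧ i ≤ 2 * (s + 1) then 1 else 0) := by
  simp only [PowerSeries.coeff_mul, coeff_smallestGenFun, coeff_genFun_ok, sum_mul_sum]
  rw [sum_comm, pairSum]
  push_cast
  refine sum_congr rfl fun ab hab => ?_
  rw [HasAntidiagonal.mem_antidiagonal] at hab
  rw [sum_comm (s := range n)]
  refine sum_congr rfl fun p _ => ?_
  rw [sum_comm (s := range n)]
  refine sum_congr rfl fun r _ => ?_
  have h := sum_smallest_eq (show ab.1 ≤ n by omega) p fun s =>
    if ∀ i ∈ r.parts, s < i ∧ i ≤ 2 * s then excess (d s) (smallestCount p) else 0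
  simp only [← ite_and] at h
  refine Eq.trans ?_ (h.symm.trans ?_)
  · by_cases hP : IsPP p r
    · rw [if_pos hP]; exact (if_pos hP).symm
    · rw [if_neg hP]; exact (if_neg hP).symm
  · refine sum_congr rfl fun s _ => ?_
    simp only [imp_true_iff, and_true, mul_ite, mul_one, mul_zero, ← ite_and]
    split_ifs <;> first | rfl | (exfalso; tauto)

theorem coeff_evalZ_eq {S : ZQSeries} {c : ℕ → ℤ}
    (h : ∀ M, modXPow ℤ M (PowerSeries.mk c) = evalMod 1 M S) (N : ℕ) :
    PowerSeries.coeff N (evalZ (1 : ℤˣ) S) = c N := by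
  have := h (N + 1)
  rw [evalMod, RingHom.comp_apply, modXPow_eq_iff] at this
  rw [← this N (Nat.lt_succ_self N), PowerSeries.coeff_mk]

theorem tail_mul_map_crankFactor (M n : ℕ) (hn : 1 ≤ n) :
    tail (modXPow ℤ M PowerSeries.X) M n ^ 2 * evalMod (1 : ℤˣ) M (crankFactor n) = 1 := by
  have h := isCrankFactor_map (evalMod_q_pow (M := M) (1 : ℤˣ)) n hn
  simpa [evalMod_z, evalMod_q, tail, sq] using h

theorem coeff_pair_of_lt (d s n : ℕ) (hn : n < s + 1) (G : ℤ⟦X⟧) :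
    PowerSeries.coeff n (smallestGenFun (excess d) (fun _ => True) (s + 1) * G) = 0 := by
  rw [PowerSeries.coeff_mul]
  refine sum_eq_zero fun ab hab => ?_
  rw [HasAntidiagonal.mem_antidiagonal] at hab
  rw [coeff_smallestGenFun_of_lt _ _ (show ab.1 < s + 1 by omega), zero_mul]

theorem coeff_evalZ_one_SA5 (N : ℕ) : PowerSeries.coeff N (evalZ (1 : ℤˣ) SA5) = sptA5 N := by
  refine coeff_evalZ_eq (c := fun n => (sptA5 n : ℤ)) (fun M => ?_) N
  rw [map_mk_sum (c := fun n => (sptA5 n : ℤ)) modXPow_X_pow (pairSum_eq_sum fun s => s)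
    (G := fun s => smallestGenFun (excess s) (fun _ => True) s *
        Nat.Partition.genFun fun i _ => if s < i ∧ i ≤ 2 * s then 1 else 0)
    (fun s n hn => coeff_pair_of_lt _ s n hn _),
    map_SA5 (evalMod_q_pow 1), evalMod_q]
  refine sum_congr rfl fun s hs => ?_
  rw [map_pair_term modXPow_X_pow (tail_mul_map_crankFactor M) _ (mem_range.mp hs)]
  ring_nf

theorem coeff_evalZ_one_SA7 (N : ℕ) : PowerSeries.coeff N (evalZ (1 : ℤˣ) SA7) = sptA7 N := by
  refine coeff_evalZ_eq (c := fun n => (sptA7 n : ℤ)) (fun M => ?_) N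
  rw [map_mk_sum (c := fun n => (sptA7 n : ℤ)) modXPow_X_pow (pairSum_eq_sum fun s => s - 1)
    (G := fun s => smallestGenFun (excess (s - 1)) (fun _ => True) s *
        Nat.Partition.genFun fun i _ => if s < i ∧ i ≤ 2 * s then 1 else 0)
    (fun s n hn => coeff_pair_of_lt _ s n hn _),
    map_SA7 (evalMod_q_pow 1), evalMod_q]
  refine sum_congr rfl fun s hs => ?_
  rw [map_pair_term modXPow_X_pow (tail_mul_map_crankFactor M) _ (mem_range.mp hs),
    Nat.add_sub_cancel, sq (s + 1)]

theorem coeff_evalZ_one_SC5 (N : ℕ) : PowerSeries.coeff N (evalZ (1 : ℤˣ) SC5) = sptC5 N := by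
  refine coeff_evalZ_eq (fun M => ?_) N
  set x := modXPow ℤ M PowerSeries.X with hx
  have hx0 : x ^ M = 0 := modXPow_X_pow
  have hmk : PowerSeries.mk sptC5 = PowerSeries.mk (fun n => (sptC1 n : ℤ)) -
      PowerSeries.expand 2 two_ne_zero (PowerSeries.mk fun n => (spt n : ℤ)) := by
    ext n
    rw [map_sub, PowerSeries.coeff_mk, PowerSeries.coeff_mk, PowerSeries.coeff_expand, sptC5]
    simp only [even_iff_two_dvd, PowerSeries.coeff_mk]
  -- The substitution q → q² followed by reduction lets `map_spt_term` give the spt series in q²;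
  -- the inverses of `evenTail x M n ^ 2` serve as its crank factors.
  set φ : ℤ⟦X⟧ →+* _ := (modXPow ℤ M).comp
    (PowerSeries.expand (R := ℤ) 2 two_ne_zero : ℤ⟦X⟧ →ₐ[ℤ] ℤ⟦X⟧).toRingHom with hφ
  have hφX : φ PowerSeries.X = x ^ 2 := by simp [hφ, hx]
  have hce : ∀ n, 1 ≤ n → evenTail x M n ^ 2 * Ring.inverse (evenTail x M n ^ 2) = 1 :=
    fun n hn => Ring.mul_inverse_cancel _ ((isUnit_evenTail hx0 (by omega)).pow 2)
  have key := sum_C1_eq hx0 (tail_mul_map_crankFactor M) hce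
  have h1 : modXPow ℤ M (PowerSeries.mk fun n => (sptC1 n : ℤ)) = _ :=
    map_mk_sum modXPow_X_pow sptC1_eq_sum
      (G := fun s => smallestGenFun (excess 0) (fun i => Odd i → i < 2 * s) s)
      (fun s n hn => coeff_smallestGenFun_of_lt _ _ hn)
  have h2 : φ (PowerSeries.mk fun n => (spt n : ℤ)) = _ :=
    map_mk_sum (M := M) (by rw [hφX]; exact sq_pow_eq_zero hx0) spt_eq_sum
      (G := fun s => smallestGenFun (excess 0) (fun _ => True) s)
      (fun s n hn => coeff_smallestGenFun_of_lt _ _ hn)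
  rw [hmk, map_sub, map_SC5 (evalMod_q_pow 1), evalMod_q, ← hx, h1, sub_eq_iff_eq_add]
  change _ = _ + φ (PowerSeries.mk fun n => (spt n : ℤ))
  rw [h2]
  refine Eq.trans (sum_congr rfl fun s hs => map_sptC1_term modXPow_X_pow
    (tail_mul_map_crankFactor M) (mem_range.mp hs)) (key.trans ?_)
  congr 1
  refine sum_congr rfl fun s hs => ?_
  rw [map_spt_term (φ := φ) (M := M) (by rw [hφX]; exact sq_pow_eq_zero hx0)
    (cf := fun n => Ring.inverse (evenTail x M n ^ 2)) (by rw [hφX]; exact hce) (mem_range.mp hs),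
    hφX, evenTail, ← pow_mul]

end GeneratingFunctions

end SptCrank

theorem mainTheorem11 (n : ℕ) (k : ℤ) (hk₀ : 0 ≤ k) (hk₅ : k < 5) :
    (SptCrank.crankResidue SptCrank.SA5 k 5 (5 * n + 4) : ℚ) =
        1 / 5 * (SptCrank.sptA5 (5 * n + 4) : ℚ) ∧
      (SptCrank.crankResidue SptCrank.SA7 k 5 (5 * n + 4) : ℚ) =
        1 / 5 * (SptCrank.sptA7 (5 * n + 4) : ℚ) ∧
      (SptCrank.crankResidue SptCrank.SC5 k 5 (5 * n + 3) : ℚ) =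
        1 / 5 * (SptCrank.sptC5 (5 * n + 3) : ℚ) := by
  have hA5 := SptCrank.five_mul_crankResidue (N := 5 * n + 4)
    (fun u hu hu' => SptCrank.coeff_evalZ_SA5 hu hu' (by omega)) hk₀ hk₅
  have hA7 := SptCrank.five_mul_crankResidue (N := 5 * n + 4)
    (fun u hu hu' => SptCrank.coeff_evalZ_SA7 hu hu' (by omega)) hk₀ hk₅
  have hC5 := SptCrank.five_mul_crankResidue (N := 5 * n + 3)
    (fun u hu hu' => SptCrank.coeff_evalZ_SC5 hu hu' (by omega)) hk₀ hk₅
  rw [SptCrank.coeff_evalZ_one_SA5] at hA5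
  rw [SptCrank.coeff_evalZ_one_SA7] at hA7
  rw [SptCrank.coeff_evalZ_one_SC5] at hC5
  have hA5' := congrArg (Int.cast : ℤ → ℚ) hA5
  have hA7' := congrArg (Int.cast : ℤ → ℚ) hA7
  have hC5' := congrArg (Int.cast : ℤ → ℚ) hC5
  push_cast at hA5' hA7' hC5'
  exact ⟨by linarith, by linarith, by linarith⟩
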